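/- Consider a unit-cost word RAM whose words have $w\ge c\lg n$ bits ($n\ge 2$, $c$ a sufficiently large constant), where all inputs are polynomially bounded in $n$: strings are over the integer alphabet $\{1,\dots,n^a\}$, and the number of strings, their lengths, the length of the pattern and the number of queries are at most $n^a$, for a constant $a$ (the constant $c$ may depend on $a$). Space is measured in words and $\lg=\log_2$. Weak prefix search for a string $q$ in a set $D$ of strings means: if at least one string of $D$ has the prefix $q$, report the interval $[l,r]$ that is exactly the set of ranks, in the lexicographic order of $D$, of the strings of $D$ with prefix $q$; if no string of $D$ has the prefix $q$, any answer is allowed. **Lemma.** Let $D$ be a nonempty set of $k$ strings and let $x$ be a positive integer. There is a data structure for $D$ (which may depend on $x$) of $O(k)$ words that supports weak prefix search for $h$ substrings of a pattern $P$ of length $m\ge 1$ in total time $O(m+h(m/x+\lg x))$. Precisely, there are one query program and one constant $C$, independent of $n$, $w$, $a$, $D$, $x$, $P$ and the queries, such that the data structure has at most $Ck$ words and, for every pattern $P$ and every list of $h$ substrings of $P$ (each given by its offset and its length, empty substrings allowed), the program halts after at most $C\,(m+h(m/x+\lg x))$ steps, having written a correct answer to every query and leaving the data structure intact. (In all cases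 the program halts within this time, also if some queried substrings prefix no string of $D$.) -/

import Mathlib

/-! ## A unit-cost word RAM

Words are natural numbers below `2 ^ w`. A machine has registers, of which a program names
finitely many, and a random access memory, addressed by words. -/

structure RamState where
  reg : ℕ → ℕ
  mem : ℕ → ℕ

namespace RamState

/-- All registers and memory cells hold `w`-bit words. -/
def IsWord (w : ℕ) (σ : RamState) : Prop :=
  (∀ i, σ.reg i < 2 ^ w) ∧ ∀ i, σ.mem i < 2 ^ w

def setReg (σ : RamState) (d v : ℕ) : RamState :=
  { σ with reg := Function.update σ.reg d v }

def setMem (σ : RamState) (a v : ℕ) : RamState :=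
  { σ with mem := Function.update σ.mem a v }

end RamState

/-- Binary operations on words. -/
inductive RamOp
  | add | sub | mul | div | mod | and | or | xor | shl | shr

/-- Arithmetic is modulo `2 ^ w`, as on a `w`-bit processor. -/
def RamOp.eval (w : ℕ) : RamOp → ℕ → ℕ → ℕ
  | add, a, b => (a + b) % 2 ^ w
  | sub, a, b => (a + (2 ^ w - b)) % 2 ^ w
  | mul, a, b => (a * b) % 2 ^ w
  | div, a, b => a / b
  | mod, a, b => a % b
  | and, a, b => a &&& b
  | or, a, b => a ||| b
  | xor, a, b => a ^^^ b
  | shl, a, b => (a <<< b) % 2 ^ w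
  | shr, a, b => a >>> b

/-- Comparisons of two registers. -/
inductive RamTest
  | lt (r s : ℕ)
  | le (r s : ℕ)
  | eq (r s : ℕ)
  | ne (r s : ℕ)

def RamTest.Holds : RamTest → RamState → Prop
  | lt r s, σ => σ.reg r < σ.reg s
  | le r s, σ => σ.reg r ≤ σ.reg s
  | eq r s, σ => σ.reg r = σ.reg s
  | ne r s, σ => σ.reg r ≠ σ.reg s

/-- RAM programs. The arguments `d`, `r`, `s` are register numbers. -/
inductive RamProg
  | skip
  /-- `reg d := v` -/
  | const (d v : ℕ)
  /-- `reg d := reg r` -/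
  | move (d r : ℕ)
  /-- `reg d := o (reg r) (reg s)` -/
  | op (o : RamOp) (d r s : ℕ)
  /-- `reg d := mem[reg r]` -/
  | load (d r : ℕ)
  /-- `mem[reg r] := reg s` -/
  | store (r s : ℕ)
  | seq (p q : RamProg)
  | ite (b : RamTest) (p q : RamProg)
  | loop (b : RamTest) (p : RamProg)

/-- `RamExec w p σ σ' t`: on a RAM with word size `w`, the program `p` started in state `σ` halts
in state `σ'` after exactly `t` steps. Every elementary instruction and every evaluation of a test
is one step. -/
inductive RamExec (w : ℕ) : RamProg → RamState → RamState → ℕ → Prop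
  | skip (σ) : RamExec w .skip σ σ 1
  | const (d v σ) : RamExec w (.const d v) σ (σ.setReg d (v % 2 ^ w)) 1
  | move (d r σ) : RamExec w (.move d r) σ (σ.setReg d (σ.reg r)) 1
  | op (o d r s σ) : RamExec w (.op o d r s) σ (σ.setReg d (o.eval w (σ.reg r) (σ.reg s))) 1
  | load (d r σ) : RamExec w (.load d r) σ (σ.setReg d (σ.mem (σ.reg r))) 1
  | store (r s σ) : RamExec w (.store r s) σ (σ.setMem (σ.reg r) (σ.reg s)) 1
  | seq {p q σ₁ σ₂ σ₃ t₁ t₂} : RamExec w p σ₁ σ₂ t₁ → RamExec w q σ₂ σ₃ t₂ →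
      RamExec w (.seq p q) σ₁ σ₃ (t₁ + t₂)
  | iteTrue {b p q σ σ' t} : b.Holds σ → RamExec w p σ σ' t →
      RamExec w (.ite b p q) σ σ' (1 + t)
  | iteFalse {b p q σ σ' t} : ¬ b.Holds σ → RamExec w q σ σ' t →
      RamExec w (.ite b p q) σ σ' (1 + t)
  | loopStop {b p σ} : ¬ b.Holds σ → RamExec w (.loop b p) σ σ 1
  | loopStep {b p σ₁ σ₂ σ₃ t₁ t₂} : b.Holds σ₁ → RamExec w p σ₁ σ₂ t₁ →
      RamExec w (.loop b p) σ₂ σ₃ t₂ → RamExec w (.loop b p) σ₁ σ₃ (1 + t₁ + t₂)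

/-- The machine is deterministic: the final state and the number of steps are functions of the
program and of the initial state. -/
theorem RamExec.det {w : ℕ} {p : RamProg} {σ σ₁ σ₂ : RamState} {t₁ t₂ : ℕ}
    (h₁ : RamExec w p σ σ₁ t₁) (h₂ : RamExec w p σ σ₂ t₂) : σ₁ = σ₂ ∧ t₁ = t₂ := by
  induction h₁ generalizing σ₂ t₂ with
  | skip | const | move | op | load | store => cases h₂; exact ⟨rfl, rfl⟩
  | seq _ _ ih₁ ih₂ =>
    cases h₂ with
    | seq a b =>
      obtain ⟨rfl, rfl⟩ := ih₁ a
      obtain ⟨rfl, rfl⟩ := ih₂ b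
      exact ⟨rfl, rfl⟩
  | iteTrue hb _ ih =>
    cases h₂ with
    | iteTrue _ a => obtain ⟨rfl, rfl⟩ := ih a; exact ⟨rfl, rfl⟩
    | iteFalse hn _ => exact absurd hb hn
  | iteFalse hn _ ih =>
    cases h₂ with
    | iteTrue hb _ => exact absurd hb hn
    | iteFalse _ a => obtain ⟨rfl, rfl⟩ := ih a; exact ⟨rfl, rfl⟩
  | loopStop hn =>
    cases h₂ with
    | loopStop _ => exact ⟨rfl, rfl⟩
    | loopStep hb _ _ => exact absurd hb hn
  | loopStep hb _ _ ih₁ ih₂ =>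
    cases h₂ with
    | loopStop hn => exact absurd hb hn
    | loopStep _ a b =>
      obtain ⟨rfl, rfl⟩ := ih₁ a
      obtain ⟨rfl, rfl⟩ := ih₂ b
      exact ⟨rfl, rfl⟩

/-! ## Weak prefix search -/

/-- `s` is a string over the integer alphabet `{1, …, N}`. -/
def IsStringOver (N : ℕ) (s : List ℕ) : Prop :=
  ∀ c ∈ s, 1 ≤ c ∧ c ≤ N

/-- The rank (from `1` to `|D|`) of `s ∈ D` in the lexicographic order of `D`, in which a proper
prefix of a string precedes the string. -/
def lexRank (D : Finset (List ℕ)) (s : List ℕ) : ℕ :=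
  (D.filter (fun t => t ≤ s)).card

/-- The interval `[l, r]` is a correct answer to the weak prefix search query `q`: if some string of
`D` has the prefix `q`, then `[l, r]` is exactly the set of ranks of the strings with prefix `q`. -/
def IsWeakPrefixAnswer (D : Finset (List ℕ)) (q : List ℕ) (l r : ℕ) : Prop :=
  (∃ s ∈ D, q <+: s) →
    {i | ∃ s ∈ D, q <+: s ∧ lexRank D s = i} = Set.Icc l r

/-- The substring of `P` of length `q.2` that starts after the first `q.1` characters. -/
def substringAt (P : List ℕ) (q : ℕ × ℕ) : List ℕ :=
  (P.drop q.1).take q.2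

/-- The contents of the memory before a batch of queries, from address `0` on: the data structure,
the pattern, and the queried substrings, each given by its offset and its length. -/
def batchInput (data P : List ℕ) (Q : List (ℕ × ℕ)) : List ℕ :=
  data ++ P ++ Q.flatMap (fun q => [q.1, q.2])

/-- Initial states for a batch of queries. Registers `0, …, 4` hold the address and the length of
the pattern, the address and the number of the queries, and the address at which the answers are to
be written (just behind the input). Other registers and cells hold arbitrary words. -/
structure IsBatchStart (w : ℕ) (data P : List ℕ) (Q : List (ℕ × ℕ)) (σ : RamState) : Prop where
  isWord : σ.IsWord w
  mem_eq : ∀ i v, (batchInput data P Q)[i]? = some v → σ.mem i = v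
  reg_pattern : σ.reg 0 = data.length
  reg_patternLength : σ.reg 1 = P.length
  reg_queries : σ.reg 2 = data.length + P.length
  reg_queryCount : σ.reg 3 = Q.length
  reg_answers : σ.reg 4 = (batchInput data P Q).length

/-- Final states of a batch of queries: the data structure is intact, and two consecutive cells for
each query hold a correct answer to it. -/
structure IsBatchEnd (D : Finset (List ℕ)) (data P : List ℕ) (Q : List (ℕ × ℕ)) (σ : RamState) :
    Prop where
  data_eq : ∀ i v, data[i]? = some v → σ.mem i = v
  answer : ∀ i q, Q[i]? = some q →
    IsWeakPrefixAnswer D (substringAt P q)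
      (σ.mem ((batchInput data P Q).length + 2 * i))
      (σ.mem ((batchInput data P Q).length + 2 * i + 1))

/-! ## Reasoning about RAM programs -/

/-! The parameter `x` plays no role in the construction. Since `lg m` is at most a constant times
`m/x + lg x` (`size_le_div_add_logb`; the case `x = 1` uses that the binary length of `m` is at most
`m`), it suffices to answer each query in time `O(lg m)` after `O(m)` work on the pattern.

The answer to `q` depends only on the set of strings of `D` with prefix `q`, hence only on the edge
of the compacted trie on which `q` lies. There are at most `2k` edges (`card_heads_le`). For each
edge two prefixes are stored: its first one, the head, and one whose length is divisible by the
highest possible power of two, the handle. Their records contain the length at which the edge ends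
and the interval of ranks.

The edge of `q` is found by fat binary search. `SearchInv` maintains an interval `[L, B)` of lengths
that, after the first probe, contains no multiple of `2 ^ n`; the next probe is at the greatest
multiple of the next smaller power below `B`. If the probed prefix of `q` is stored, its record
tells where its edge ends, and `L` moves past that end, or the search is over. If it is not stored,
the handle of its edge must be at least as long as `B`, which shows that the probed prefix already
lies on the edge of `q` (`SearchInv.miss`), and `B` moves down.

Records are addressed by Karp–Rabin fingerprints. With the fingerprints of the prefixes of the
pattern and the powers of the base tabulated, the fingerprint of any substring takes constant time.
A counting argument gives a base that is injective on all prefixes of strings of `D`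
(`fingerprint.exists_base`), and two-level perfect hashing puts the `O(k)` keys into `O(k)` words
(`exists_perfect_hash`). Matches need no verification: for queries that prefix a string of `D` false
matches are impossible, and for other queries only the running time matters. -/

namespace RamState

@[simp] theorem setReg_reg (σ : RamState) (d v i : ℕ) :
    (σ.setReg d v).reg i = if i = d then v else σ.reg i := by
  simp [setReg, Function.update_apply]

@[simp] theorem setReg_mem (σ : RamState) (d v : ℕ) : (σ.setReg d v).mem = σ.mem := rfl

@[simp] theorem setMem_mem (σ : RamState) (a v i : ℕ) :
    (σ.setMem a v).mem i = if i = a then v else σ.mem i := by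
  simp [setMem, Function.update_apply]

@[simp] theorem setMem_reg (σ : RamState) (a v : ℕ) : (σ.setMem a v).reg = σ.reg := rfl

end RamState

/-! ### Syntactic classes of programs and frame properties. -/

namespace RamProg

/-- Sequential composition of a list of programs. -/
def block : List RamProg → RamProg
  | [] => skip
  | p :: l => seq p (block l)

/-- The programs without branches and loops. -/
def IsStraight : RamProg → Prop
  | seq p q => p.IsStraight ∧ q.IsStraight
  | ite _ _ _ => False
  | loop _ _ => False
  | _ => True

/-- The final state of a straight-line program. -/
def run (w : ℕ) : RamProg → RamState → RamState
  | skip, σ => σ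
  | const d v, σ => σ.setReg d (v % 2 ^ w)
  | move d r, σ => σ.setReg d (σ.reg r)
  | op o d r s, σ => σ.setReg d (o.eval w (σ.reg r) (σ.reg s))
  | load d r, σ => σ.setReg d (σ.mem (σ.reg r))
  | store r s, σ => σ.setMem (σ.reg r) (σ.reg s)
  | seq p q, σ => q.run w (p.run w σ)
  | ite _ _ _, σ => σ
  | loop _ _, σ => σ

/-- The programs without loops. -/
def IsLoopFree : RamProg → Prop
  | seq p q => p.IsLoopFree ∧ q.IsLoopFree
  | ite _ p q => p.IsLoopFree ∧ q.IsLoopFree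
  | loop _ _ => False
  | _ => True

/-- A bound for the number of steps of a loop-free program. -/
def cost : RamProg → ℕ
  | ite _ p q => 1 + max p.cost q.cost
  | seq p q => p.cost + q.cost
  | _ => 1

theorem IsStraight.exec {w : ℕ} {p : RamProg} (h : p.IsStraight) (σ : RamState) :
    RamExec w p σ (p.run w σ) p.cost := by
  induction p generalizing σ with
  | skip => exact .skip σ
  | const d v => exact .const d v σ
  | move d r => exact .move d r σ
  | op o d r s => exact .op o d r s σ
  | load d r => exact .load d r σ
  | store r s => exact .store r s σ
  | seq p q ihp ihq => exact .seq (ihp h.1 σ) (ihq h.2 _)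
  | ite => exact h.elim
  | loop => exact h.elim

/-- The register `i` is not written. -/
def Keeps (i : ℕ) : RamProg → Prop
  | skip => True
  | const d _ => i ≠ d
  | move d _ => i ≠ d
  | op _ d _ _ => i ≠ d
  | load d _ => i ≠ d
  | store _ _ => True
  | seq p q => p.Keeps i ∧ q.Keeps i
  | ite _ p q => p.Keeps i ∧ q.Keeps i
  | loop _ p => p.Keeps i

/-- The memory is only read. -/
def ReadOnly : RamProg → Prop
  | store _ _ => False
  | seq p q => p.ReadOnly ∧ q.ReadOnly
  | ite _ p q => p.ReadOnly ∧ q.ReadOnly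
  | loop _ p => p.ReadOnly
  | _ => True

end RamProg

theorem RamExec.reg_eq {w i : ℕ} {p : RamProg} {σ σ' : RamState} {t : ℕ}
    (h : RamExec w p σ σ' t) (hp : p.Keeps i) :
    σ'.reg i = σ.reg i := by
  induction h with
  | skip => rfl
  | const | move | op | load =>
    simp only [RamProg.Keeps] at hp
    rw [RamState.setReg_reg, if_neg hp]
  | store => rfl
  | seq _ _ ih₁ ih₂ => rw [ih₂ hp.2, ih₁ hp.1]
  | iteTrue _ _ ih => exact ih hp.1
  | iteFalse _ _ ih => exact ih hp.2
  | loopStop => rfl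
  | loopStep _ _ _ ih₁ ih₂ => rw [ih₂ hp, ih₁ hp]

theorem RamExec.mem_eq {w : ℕ} {p : RamProg} {σ σ' : RamState} {t : ℕ}
    (h : RamExec w p σ σ' t) (hp : p.ReadOnly) : σ'.mem = σ.mem := by
  induction h with
  | skip | const | move | op | load => rfl
  | store => exact hp.elim
  | seq _ _ ih₁ ih₂ => rw [ih₂ hp.2, ih₁ hp.1]
  | iteTrue _ _ ih => exact ih hp.1
  | iteFalse _ _ ih => exact ih hp.2
  | loopStop => rfl
  | loopStep _ _ _ ih₁ ih₂ => rw [ih₂ hp, ih₁ hp]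

theorem RamProg.IsStraight.run_reg {w i : ℕ} {p : RamProg} {σ : RamState} (h : p.IsStraight)
    (hp : p.Keeps i) : (p.run w σ).reg i = σ.reg i := (h.exec σ).reg_eq hp

theorem RamProg.IsStraight.run_mem {w : ℕ} {p : RamProg} {σ : RamState} (h : p.IsStraight)
    (hp : p.ReadOnly) : (p.run w σ).mem = σ.mem := (h.exec σ).mem_eq hp

/-! ### Hoare-style rules with time bounds. -/

/-- Total correctness: started in `σ`, the program `p` halts within `T` steps in a state that
satisfies `Q`. -/
def Halts (w : ℕ) (p : RamProg) (σ : RamState) (T : ℕ) (Q : RamState → Prop) : Prop :=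
  ∃ σ' t, RamExec w p σ σ' t ∧ t ≤ T ∧ Q σ'

namespace Halts

variable {w : ℕ} {p q : RamProg} {σ : RamState} {T T₁ T₂ : ℕ} {Q R : RamState → Prop}

theorem mono (h : Halts w p σ T₁ Q) (hT : T₁ ≤ T₂) (hQ : ∀ σ', Q σ' → R σ') :
    Halts w p σ T₂ R := by
  obtain ⟨σ', t, he, ht, hq⟩ := h
  exact ⟨σ', t, he, ht.trans hT, hQ _ hq⟩

theorem straight (hp : p.IsStraight) (hT : p.cost ≤ T) (hQ : Q (p.run w σ)) : Halts w p σ T Q :=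
  ⟨_, _, hp.exec σ, hT, hQ⟩

theorem seq (hp : Halts w p σ T₁ R) (hq : ∀ σ', R σ' → Halts w q σ' T₂ Q) (hT : T₁ + T₂ ≤ T) :
    Halts w (.seq p q) σ T Q := by
  obtain ⟨σ₁, t₁, h₁, l₁, r₁⟩ := hp
  obtain ⟨σ₂, t₂, h₂, l₂, r₂⟩ := hq σ₁ r₁
  exact ⟨σ₂, t₁ + t₂, .seq h₁ h₂, by omega, r₂⟩

theorem ite {b : RamTest} (hp : b.Holds σ → Halts w p σ T₁ Q) (hq : ¬ b.Holds σ → Halts w q σ T₁ Q)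
    (hT : 1 + T₁ ≤ T) : Halts w (.ite b p q) σ T Q := by
  by_cases hb : b.Holds σ
  · obtain ⟨σ', t, h, l, r⟩ := hp hb
    exact ⟨σ', 1 + t, .iteTrue hb h, by omega, r⟩
  · obtain ⟨σ', t, h, l, r⟩ := hq hb
    exact ⟨σ', 1 + t, .iteFalse hb h, by omega, r⟩

/-- A loop with the invariant `I n`, where `n` is the number of the remaining iterations. -/
theorem loop {b : RamTest} (I : ℕ → RamState → Prop)
    (hstep : ∀ n σ, I (n + 1) σ → b.Holds σ ∧ Halts w p σ T₁ (I n))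
    (hdone : ∀ σ, I 0 σ → ¬ b.Holds σ) (n : ℕ) (h0 : I n σ) (hT : n * (1 + T₁) + 1 ≤ T) :
    Halts w (.loop b p) σ T (I 0) := by
  induction n generalizing σ T with
  | zero => exact ⟨σ, 1, .loopStop (hdone σ h0), by omega, h0⟩
  | succ n ih =>
    obtain ⟨hb, σ₁, t₁, h₁, l₁, r₁⟩ := hstep n σ h0
    obtain ⟨σ₂, t₂, h₂, l₂, r₂⟩ := ih r₁ le_rfl
    refine ⟨σ₂, 1 + t₁ + t₂, .loopStep hb h₁ h₂, ?_, r₂⟩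
    have : (n + 1) * (1 + T₁) = n * (1 + T₁) + 1 + T₁ := by ring
    omega

/-- What a program does not write is left unchanged. -/
theorem frame (hr : p.ReadOnly) (h : Halts w p σ T Q) :
    Halts w p σ T (fun σ' => Q σ' ∧ σ'.mem = σ.mem ∧ ∀ i, p.Keeps i → σ'.reg i = σ.reg i) := by
  obtain ⟨σ', t, he, ht, hq⟩ := h
  exact ⟨σ', t, he, ht, hq, he.mem_eq hr, fun i hi => he.reg_eq hi⟩

/-- Bounds the time of a probe when nothing is known about the state, as happens for queries that
prefix no string of `D`. -/
theorem of_loopFree (hp : p.IsLoopFree) (hT : p.cost ≤ T) : Halts w p σ T (fun _ => True) := by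
  induction p generalizing σ T with
  | skip => exact straight trivial hT trivial
  | const => exact straight trivial hT trivial
  | move => exact straight trivial hT trivial
  | op => exact straight trivial hT trivial
  | load => exact straight trivial hT trivial
  | store => exact straight trivial hT trivial
  | seq p q ihp ihq => exact seq (ihp hp.1 le_rfl) (fun _ _ => ihq hp.2 le_rfl) hT
  | ite b p q ihp ihq =>
    exact ite (fun _ => ihp hp.1 (le_max_left _ _)) (fun _ => ihq hp.2 (le_max_right _ _)) hT
  | loop => exact hp.elim

end Halts

/-! ## The trie of a set of strings -/

/-- The strings of `D` with prefix `u`. -/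
def withPrefix (D : Finset (List ℕ)) (u : List ℕ) : Finset (List ℕ) :=
  D.filter (fun s => u <+: s)

/-- The prefixes of the strings of `D`. -/
def prefixes (D : Finset (List ℕ)) : Finset (List ℕ) :=
  D.biUnion (fun s => s.inits.toFinset)

section trie

variable {D : Finset (List ℕ)} {u v q s t : List ℕ}

theorem mem_withPrefix : s ∈ withPrefix D u ↔ s ∈ D ∧ u <+: s := by
  simp [withPrefix]

theorem mem_prefixes : u ∈ prefixes D ↔ ∃ s ∈ D, u <+: s := by
  simp [prefixes]

theorem mem_prefixes_iff_nonempty : u ∈ prefixes D ↔ (withPrefix D u).Nonempty := by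
  simp only [mem_prefixes, Finset.Nonempty, mem_withPrefix]

theorem withPrefix_anti (h : u <+: v) : withPrefix D v ⊆ withPrefix D u := by
  intro s hs
  rw [mem_withPrefix] at hs ⊢
  exact ⟨hs.1, h.trans hs.2⟩

theorem mem_prefixes_of_prefix (h : u <+: v) (hv : v ∈ prefixes D) : u ∈ prefixes D := by
  rw [mem_prefixes_iff_nonempty] at hv ⊢
  exact hv.mono (withPrefix_anti h)

theorem prefix_total_of_withPrefix_subset (hv : v ∈ prefixes D)
    (h : withPrefix D v ⊆ withPrefix D u) : u <+: v ∨ v <+: u := by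
  obtain ⟨s, hs⟩ := mem_prefixes_iff_nonempty.1 hv
  exact List.prefix_or_prefix_of_prefix (mem_withPrefix.1 (h hs)).2 (mem_withPrefix.1 hs).2

/-- The strings with a given prefix are contiguous in the lexicographic order. -/
theorem prefix_of_le_of_le {r : List ℕ} (hs : u <+: s) (ht : u <+: t) (h₁ : s ≤ r) (h₂ : r ≤ t) :
    u <+: r := by
  induction u generalizing s t r with
  | nil => exact List.nil_prefix
  | cons c u ih =>
    obtain ⟨s', rfl⟩ := hs
    obtain ⟨t', rfl⟩ := ht
    cases r with
    | nil => exact absurd h₁ (not_le.2 (by simp))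
    | cons d r =>
      rw [← not_lt, List.cons_append, List.cons_lt_cons_iff] at h₁ h₂
      obtain rfl : c = d := by omega
      rw [List.cons_prefix_cons]
      refine ⟨rfl, ih (u.prefix_append s') (u.prefix_append t') ?_ ?_⟩
      · simpa using h₁
      · simpa using h₂

/-! ### Ranks -/

theorem lexRank_le_lexRank_iff (hs : s ∈ D) :
    lexRank D s ≤ lexRank D t ↔ s ≤ t := by
  have mono : ∀ {a b : List ℕ}, a ≤ b → lexRank D a ≤ lexRank D b := fun hab =>
    Finset.card_le_card (Finset.monotone_filter_right _ fun _ _ h => le_trans h hab)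
  refine ⟨fun h => ?_, mono⟩
  by_contra hlt
  have hlt : t < s := not_le.1 hlt
  refine absurd h (not_le.2 (Finset.card_lt_card ?_))
  rw [Finset.ssubset_iff_of_subset
    (Finset.monotone_filter_right _ fun _ _ h => le_trans h hlt.le)]
  exact ⟨s, by simp [hs], by simp [hlt]⟩

theorem lexRank_injOn : Set.InjOn (lexRank D) D := by
  intro s hs t ht h
  exact le_antisymm ((lexRank_le_lexRank_iff hs).1 h.le) ((lexRank_le_lexRank_iff ht).1 h.ge)

theorem lexRank_le_card (s : List ℕ) : lexRank D s ≤ D.card := Finset.card_filter_le _ _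

/-- Ranks are injective with values between `1` and `D.card`, so counting makes them onto. Hence
every number between two ranks is itself a rank. -/
theorem image_lexRank : D.image (lexRank D) = Finset.Icc 1 D.card := by
  refine Finset.eq_of_subset_of_card_le ?_ ?_
  · intro i hi
    obtain ⟨s, hs, rfl⟩ := Finset.mem_image.1 hi
    rw [Finset.mem_Icc]
    exact ⟨Finset.card_pos.2 ⟨s, by simp [hs]⟩, lexRank_le_card s⟩
  · rw [Finset.card_image_of_injOn lexRank_injOn]
    simp

/-- The least rank of a string with prefix `u`. -/
def loRank (D : Finset (List ℕ)) (u : List ℕ) : ℕ :=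
  if h : (withPrefix D u).Nonempty then lexRank D ((withPrefix D u).min' h) else 0

/-- The greatest rank of a string with prefix `u`. -/
def hiRank (D : Finset (List ℕ)) (u : List ℕ) : ℕ :=
  if h : (withPrefix D u).Nonempty then lexRank D ((withPrefix D u).max' h) else 0

theorem loRank_le_card : loRank D u ≤ D.card := by
  unfold loRank; split_ifs
  · exact lexRank_le_card _
  · exact Nat.zero_le _

theorem hiRank_le_card : hiRank D u ≤ D.card := by
  unfold hiRank; split_ifs
  · exact lexRank_le_card _
  · exact Nat.zero_le _

/-- Strings with a common prefix are contiguous, so their ranks fill the interval from least to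
greatest. The answer depends on the set alone, so it may be read off any prefix `u` on the same edge
as `q`. -/
theorem isWeakPrefixAnswer_rank (h : withPrefix D u = withPrefix D q) :
    IsWeakPrefixAnswer D q (loRank D u) (hiRank D u) := by
  intro hq
  have hne : (withPrefix D u).Nonempty := by
    rw [h]; exact mem_prefixes_iff_nonempty.1 (mem_prefixes.2 hq)
  have hmin := Finset.min'_mem _ hne
  have hmax := Finset.max'_mem _ hne
  simp only [loRank, hiRank, hne, dite_true]
  have hmin' := mem_withPrefix.1 (h.subset hmin)
  have hmax' := mem_withPrefix.1 (h.subset hmax)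
  ext i
  constructor
  · rintro ⟨s, hs, hqs, rfl⟩
    have hsu : s ∈ withPrefix D u := by rw [h]; exact mem_withPrefix.2 ⟨hs, hqs⟩
    exact ⟨(lexRank_le_lexRank_iff hmin'.1).2 (Finset.min'_le _ _ hsu),
      (lexRank_le_lexRank_iff hs).2 (Finset.le_max' _ _ hsu)⟩
  · rintro ⟨hi₁, hi₂⟩
    have : i ∈ D.image (lexRank D) := by
      rw [image_lexRank, Finset.mem_Icc]
      refine ⟨le_trans ?_ hi₁, hi₂.trans (lexRank_le_card _)⟩
      exact Finset.card_pos.2 ⟨_, Finset.mem_filter.2 ⟨hmin'.1, le_rfl⟩⟩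
    obtain ⟨s, hs, rfl⟩ := Finset.mem_image.1 this
    exact ⟨s, hs, prefix_of_le_of_le hmin'.2 hmax'.2 ((lexRank_le_lexRank_iff hmin'.1).1 hi₁)
      ((lexRank_le_lexRank_iff hs).1 hi₂), rfl⟩

/-! ### Heads of edges -/

/-- The first prefixes on the edges of the compacted trie. -/
def heads (D : Finset (List ℕ)) : Finset (List ℕ) :=
  (prefixes D).filter (fun u => u = [] ∨ withPrefix D u ≠ withPrefix D u.dropLast)

theorem mem_heads : u ∈ heads D ↔
    u ∈ prefixes D ∧ (u = [] ∨ withPrefix D u ≠ withPrefix D u.dropLast) := by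
  simp [heads]

/-- An edge head is determined by its least and by its greatest string. -/
theorem card_filter_le_of_shortest (H : Finset (List ℕ)) (R : List ℕ → List ℕ → Prop)
    (hex : ∀ u ∈ H, ∃ s ∈ D, u <+: s ∧ R u s ∧ (u ≠ [] → ¬ R u.dropLast s))
    (hmono : ∀ u v s, u <+: v → v <+: s → R u s → R v s) : H.card ≤ D.card := by
  choose! f hf using hex
  refine Finset.card_le_card_of_injOn f (fun u hu => (hf u hu).1) ?_
  -- Two elements charged to the same string are prefixes of it, hence comparable. If `u` were a
  -- proper prefix of `v`, then `R` would pass from `u` to `v.dropLast`, against the choice of `f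
  -- v`.
  have key : ∀ u ∈ H, ∀ v ∈ H, f u = f v → u.length ≤ v.length → u = v := by
    intro u hu v hv huv hl
    obtain ⟨-, hus, hR, -⟩ := hf u hu
    obtain ⟨-, hvs, -, hR'⟩ := hf v hv
    rw [huv] at hus hR
    have hpre : u <+: v := List.prefix_of_prefix_length_le hus hvs hl
    rcases hpre.length_le.lt_or_eq with hlt | heq
    · exfalso
      have hv0 : v ≠ [] := by rintro rfl; simp at hlt
      refine hR' hv0 (hmono u _ _ ?_ ((List.dropLast_prefix v).trans hvs) hR)
      exact List.prefix_of_prefix_length_le hpre (List.dropLast_prefix v)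
        (by rw [List.length_dropLast]; omega)
    · exact hpre.eq_of_length heq
  intro u hu v hv huv
  rcases le_total u.length v.length with h | h
  · exact key u hu v hv huv h
  · exact (key v hv u hu huv.symm h).symm

/-- At a nonempty head the set of strings shrinks strictly compared with the parent prefix. Since
both sets are contiguous, the least or the greatest string must change. Charging the head to that
string uses each string at most once as a minimum (`A`) and once as a maximum (`B`). -/
theorem card_heads_le : (heads D).card ≤ 2 * D.card := by
  classical
  let A := (heads D).filter (fun u => ∃ s ∈ D, u <+: s ∧ (∀ r ∈ withPrefix D u, s ≤ r) ∧
    (u ≠ [] → ¬ ∀ r ∈ withPrefix D u.dropLast, s ≤ r))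
  let B := (heads D).filter (fun u => ∃ s ∈ D, u <+: s ∧ (∀ r ∈ withPrefix D u, r ≤ s) ∧
    (u ≠ [] → ¬ ∀ r ∈ withPrefix D u.dropLast, r ≤ s))
  have hA : A.card ≤ D.card := by
    refine card_filter_le_of_shortest A (fun u s => ∀ r ∈ withPrefix D u, s ≤ r)
      (fun u hu => (Finset.mem_filter.1 hu).2) ?_
    intro u v s huv _ h r hr
    exact h r (withPrefix_anti huv hr)
  have hB : B.card ≤ D.card := by
    refine card_filter_le_of_shortest B (fun u s => ∀ r ∈ withPrefix D u, r ≤ s)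
      (fun u hu => (Finset.mem_filter.1 hu).2) ?_
    intro u v s huv _ h r hr
    exact h r (withPrefix_anti huv hr)
  have hsub : heads D ⊆ A ∪ B := by
    intro u hu
    obtain ⟨hp, hh⟩ := mem_heads.1 hu
    have hne := mem_prefixes_iff_nonempty.1 hp
    have hmin := mem_withPrefix.1 (Finset.min'_mem _ hne)
    have hmax := mem_withPrefix.1 (Finset.max'_mem _ hne)
    by_contra hcon
    simp only [Finset.mem_union, A, B, Finset.mem_filter, hu, true_and, not_or, not_exists,
      not_and, Classical.not_imp, not_not] at hcon
    obtain ⟨h0, h₁⟩ := hcon.1 _ hmin.1 hmin.2 (fun r hr => Finset.min'_le _ _ hr)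
    obtain ⟨-, h₂⟩ := hcon.2 _ hmax.1 hmax.2 (fun r hr => Finset.le_max' _ _ hr)
    refine (hh.resolve_left h0) (Finset.Subset.antisymm (withPrefix_anti u.dropLast_prefix) ?_)
    intro r hr
    exact mem_withPrefix.2 ⟨(mem_withPrefix.1 hr).1,
      prefix_of_le_of_le hmin.2 hmax.2 (h₁ r hr) (h₂ r hr)⟩
  calc (heads D).card ≤ (A ∪ B).card := Finset.card_le_card hsub
    _ ≤ A.card + B.card := Finset.card_union_le _ _
    _ ≤ 2 * D.card := by omega

/-! ### Extents and handles -/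

/-- The length of the longest string on the edge of `u`. -/
def extentLength (D : Finset (List ℕ)) (u : List ℕ) : ℕ :=
  ((prefixes D).filter (fun v => withPrefix D v = withPrefix D u)).sup List.length

theorem extentLength_congr (h : withPrefix D u = withPrefix D v) :
    extentLength D u = extentLength D v := by
  simp only [extentLength, h]

theorem length_le_extentLength (hv : v ∈ prefixes D) (h : withPrefix D v = withPrefix D u) :
    v.length ≤ extentLength D u :=
  Finset.le_sup (f := List.length) (Finset.mem_filter.2 ⟨hv, h⟩)

theorem exists_extent (hu : u ∈ prefixes D) : ∃ v ∈ prefixes D,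
    withPrefix D v = withPrefix D u ∧ v.length = extentLength D u := by
  obtain ⟨v, hv, h⟩ := Finset.exists_mem_eq_sup
    ((prefixes D).filter (fun v => withPrefix D v = withPrefix D u))
    ⟨u, Finset.mem_filter.2 ⟨hu, rfl⟩⟩ List.length
  rw [Finset.mem_filter] at hv
  exact ⟨v, hv.1, hv.2, h.symm⟩

/-- Turns "on the same edge" into a comparison of lengths, which is all the machine can test. The
longest string on the edge is comparable with `q.take j`, because some string of `D` extends both.
-/
theorem withPrefix_take_eq_iff (hq : q ∈ prefixes D) {i j : ℕ} (hij : i ≤ j) (hj : j ≤ q.length) :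
    withPrefix D (q.take j) = withPrefix D (q.take i) ↔ j ≤ extentLength D (q.take i) := by
  have hqi := mem_prefixes_of_prefix (q.take_prefix i) hq
  have hqj := mem_prefixes_of_prefix (q.take_prefix j) hq
  constructor
  · intro h
    simpa [hj] using length_le_extentLength hqj h
  · intro h
    obtain ⟨v, hv, hE, hl⟩ := exists_extent hqi
    have hsub : withPrefix D (q.take j) ⊆ withPrefix D (q.take i) :=
      withPrefix_anti (List.take_prefix_take_left hij)
    refine hsub.antisymm ?_
    rw [← hE]
    refine withPrefix_anti ?_
    rw [← hE] at hsub
    rcases prefix_total_of_withPrefix_subset hqj hsub with h' | h'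
    · have : v.length = (q.take j).length := by
        have := h'.length_le
        simp only [List.length_take] at this ⊢
        omega
      rw [h'.eq_of_length this]
    · exact h'

/-- Every interval has an element that is divisible by each power of two that divides some element
of the interval. -/
theorem exists_fattest {a b : ℕ} (h : a ≤ b) :
    ∃ g, a ≤ g ∧ g ≤ b ∧ ∀ t, a ≤ t → t ≤ b → ∀ j, 2 ^ j ∣ t → 2 ^ j ∣ g := by
  rcases Nat.eq_zero_or_pos a with rfl | ha
  -- Zero is divisible by every power of two, but `padicValNat` assigns it the value `0`, so it is
  -- treated separately.
  · exact ⟨0, le_rfl, h, fun _ _ _ _ _ => dvd_zero _⟩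
  · obtain ⟨g, hg, hmax⟩ := Finset.exists_max_image (Finset.Icc a b) (padicValNat 2)
      ⟨a, Finset.mem_Icc.2 ⟨le_rfl, h⟩⟩
    rw [Finset.mem_Icc] at hg
    refine ⟨g, hg.1, hg.2, fun t h₁ h₂ j hj => ?_⟩
    have : j ≤ padicValNat 2 t := (padicValNat_dvd_iff_le (by omega)).1 hj
    exact (padicValNat_dvd_iff_le (by omega)).2
      (this.trans (hmax t (Finset.mem_Icc.2 ⟨h₁, h₂⟩)))

/-- `g` is a handle of the edge that starts with `u`. -/
def IsHandle (D : Finset (List ℕ)) (u g : List ℕ) : Prop :=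
  g ∈ prefixes D ∧ withPrefix D g = withPrefix D u ∧ u.length ≤ g.length ∧
    ∀ t, u.length ≤ t → t ≤ extentLength D u → ∀ j, 2 ^ j ∣ t → 2 ^ j ∣ g.length

/-- Truncate the longest string on the edge to the fattest length between the two ends of the edge.
-/
theorem exists_isHandle (hu : u ∈ prefixes D) : ∃ g, IsHandle D u g := by
  obtain ⟨v, hv, hE, hl⟩ := exists_extent hu
  have hle : u.length ≤ extentLength D u := length_le_extentLength hu rfl
  obtain ⟨g, h₁, h₂, h₃⟩ := exists_fattest hle
  have huv : u <+: v := by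
    rcases prefix_total_of_withPrefix_subset hv hE.subset with h | h
    · exact h
    · rw [h.eq_of_length (le_antisymm h.length_le (by omega))]
  have hlg : (v.take g).length = g := by simp; omega
  refine ⟨v.take g, mem_prefixes_of_prefix (v.take_prefix g) hv, ?_, by omega, by rwa [hlg]⟩
  refine Finset.Subset.antisymm (withPrefix_anti ?_) ?_
  · exact List.prefix_of_prefix_length_le huv (v.take_prefix g) (by omega)
  · rw [← hE]; exact withPrefix_anti (v.take_prefix g)

open Classical in
/-- A handle of the edge that starts with `u`. -/
noncomputable def handle (D : Finset (List ℕ)) (u : List ℕ) : List ℕ :=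
  if h : ∃ g, IsHandle D u g then h.choose else []

theorem isHandle_handle (hu : u ∈ prefixes D) : IsHandle D u (handle D u) := by
  unfold handle
  rw [dif_pos (exists_isHandle hu)]
  exact (exists_isHandle hu).choose_spec

/-- The prefixes for which the data structure has an entry. -/
noncomputable def stored (D : Finset (List ℕ)) : Finset (List ℕ) :=
  heads D ∪ (heads D).image (handle D)

theorem card_stored_le : (stored D).card ≤ 4 * D.card := by
  have h₁ := Finset.card_union_le (heads D) ((heads D).image (handle D))
  have h₂ : ((heads D).image (handle D)).card ≤ (heads D).card := Finset.card_image_le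
  have h₃ := card_heads_le (D := D)
  unfold stored
  omega

theorem stored_subset_prefixes : stored D ⊆ prefixes D := by
  intro u hu
  rcases Finset.mem_union.1 hu with h | h
  · exact (mem_heads.1 h).1
  · obtain ⟨v, hv, rfl⟩ := Finset.mem_image.1 h
    exact (isHandle_handle (mem_heads.1 hv).1).1

/-! ### Fat binary search -/

/-- The invariant of the search for the edge of `q`: it meets the lengths in `[L, B)`. -/
structure SearchInv (D : Finset (List ℕ)) (q : List ℕ) (n L B : ℕ) : Prop where
  le_length : L ≤ q.length
  mem_stored : q.take L ∈ stored D
  upper_le : B ≤ q.length + 1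
  upper : B ≤ q.length → withPrefix D (q.take B) = withPrefix D q
  head : L < B → L = 0 ∨ withPrefix D (q.take (L - 1)) ≠ withPrefix D (q.take L)
  fat : (∀ t, L ≤ t → t < B → ¬ 2 ^ n ∣ t) ∨ (L = 0 ∧ q.length < 2 ^ n / 2)

namespace SearchInv

variable {n L B f : ℕ}

theorem dropLast_take_of_le {j : ℕ} (hj : j ≤ q.length) :
    (q.take j).dropLast = q.take (j - 1) := by
  rw [List.dropLast_eq_take, List.take_take, List.length_take]
  congr 1; omega

theorem nil_mem_stored (hq : q ∈ prefixes D) : [] ∈ stored D :=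
  Finset.mem_union_left _ (mem_heads.2 ⟨mem_prefixes_of_prefix List.nil_prefix hq, .inl rfl⟩)

/-- The initial interval contains `0`, a multiple of every power of two; the second alternative of
`fat` exists for this state only. It forces the first probe to be at length `0`, where the stored
empty string is found. -/
theorem init (hq : q ∈ prefixes D) (hn : q.length < 2 ^ n / 2) :
    SearchInv D q n 0 (q.length + 1) where
  le_length := Nat.zero_le _
  mem_stored := by simpa using nil_mem_stored hq
  upper_le := le_rfl
  upper h := by omega
  head _ := .inl rfl
  fat := .inr ⟨rfl, hn⟩

/-- Every integer is a multiple of `2 ^ 0`, so the interval is empty. Then `q.take L` lies between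
`q.take B` and `q`, which have the same set of strings. -/
theorem withPrefix_eq (h : SearchInv D q 0 L B) :
    withPrefix D (q.take L) = withPrefix D q := by
  have hBL : B ≤ L := by
    rcases h.fat with h' | h'
    · by_contra hlt
      exact h' L le_rfl (by omega) (by simp)
    · simp at h'
  have hB := h.upper (hBL.trans h.le_length)
  refine Finset.Subset.antisymm ?_ (withPrefix_anti (q.take_prefix L))
  rw [← hB]
  exact withPrefix_anti (List.take_prefix_take_left hBL)

/-- The next length to probe: the greatest multiple of `2 ^ n` below `B`. -/
def probe (n B : ℕ) : ℕ := (B - 1) - (B - 1) % 2 ^ n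

theorem dvd_probe : 2 ^ n ∣ probe n B := Nat.dvd_sub_mod _

theorem probe_lt (h : 0 < B) : probe n B < B := by
  unfold probe; omega

theorem le_probe {t : ℕ} (ht : t < B) (hd : 2 ^ n ∣ t) : t ≤ probe n B := by
  have h₁ := Nat.div_add_mod (B - 1) (2 ^ n)
  obtain ⟨c, rfl⟩ := hd
  have h₂ : c ≤ (B - 1) / 2 ^ n :=
    (Nat.le_div_iff_mul_le (by positivity)).2 (by rw [mul_comm]; omega)
  have h₃ := Nat.mul_le_mul_left (2 ^ n) h₂
  unfold probe; omega

theorem of_le (h : SearchInv D q (n + 1) L B) (hBL : B ≤ L) : SearchInv D q n L B :=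
  ⟨h.le_length, h.mem_stored, h.upper_le, h.upper, h.head, .inl fun t _ _ => by omega⟩

theorem of_probe_lt (h : SearchInv D q (n + 1) L B) (hf : probe n B < L) : SearchInv D q n L B :=
  ⟨h.le_length, h.mem_stored, h.upper_le, h.upper, h.head, .inl fun t h₁ h₂ hd => by
    have := le_probe h₂ hd
    omega⟩

variable (hq : q ∈ prefixes D) (h : SearchInv D q (n + 1) L B) (hLB : L < B)
include hq h hLB

/-- The edge of the probed prefix ends before `q` does, so the edge of `q` is deeper, and the next
length along `q` is the start of an edge and is stored as a head. No multiple of `2 ^ n` remains,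
because the probe was the last one below `B`. -/
theorem hit_short (hf : extentLength D (q.take (probe n B)) < q.length) :
    SearchInv D q n (extentLength D (q.take (probe n B)) + 1) B := by
  have hfB : probe n B < B := probe_lt (by omega)
  have hu := h.upper_le
  have hqf := mem_prefixes_of_prefix (q.take_prefix (probe n B)) hq
  have hfe : probe n B ≤ extentLength D (q.take (probe n B)) := by
    refine le_trans ?_ (length_le_extentLength hqf rfl)
    simp; omega
  set e := extentLength D (q.take (probe n B)) with he
  have h₁ := (withPrefix_take_eq_iff hq hfe hf.le).2 le_rfl
  have h₂ : withPrefix D (q.take (e + 1)) ≠ withPrefix D (q.take (probe n B)) := by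
    rw [Ne, withPrefix_take_eq_iff hq (by omega) hf]; omega
  have h₃ : (q.take (e + 1)).dropLast = q.take e := by
    exact dropLast_take_of_le hf
  refine ⟨hf, ?_, hu, h.upper, fun _ => .inr ?_, .inl fun t ht₁ ht₂ hd => ?_⟩
  · refine Finset.mem_union_left _ (mem_heads.2
      ⟨mem_prefixes_of_prefix (q.take_prefix _) hq, .inr ?_⟩)
    rwa [h₃, h₁]
  · rw [Nat.add_sub_cancel, h₁]; exact h₂.symm
  · have := le_probe ht₂ hd
    omega

/-- The probed prefix lies on the edge of `q`; the empty interval at the probe records that the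
search is over. -/
theorem hit_long (hs : q.take (probe n B) ∈ stored D)
    (hf : q.length ≤ extentLength D (q.take (probe n B))) :
    SearchInv D q n (probe n B) (probe n B) := by
  have hfB : probe n B < B := probe_lt (by omega)
  have hu := h.upper_le
  have hfl : probe n B ≤ q.length := by omega
  have hE := (withPrefix_take_eq_iff hq hfl le_rfl).2 hf
  rw [List.take_length] at hE
  exact ⟨hfl, hs, by omega, fun _ => hE.symm, fun h => absurd h (lt_irrefl _),
    .inl fun t _ _ => by omega⟩

/-- Of two consecutive multiples of `2 ^ n` one is a multiple of `2 ^ (n + 1)`, and `[L, B)`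
contains none of those. So the probe is the only multiple of `2 ^ n` in the interval. -/
theorem not_dvd_of_miss (hs : q.take (probe n B) ∉ stored D) (hLf : L ≤ probe n B) {t : ℕ}
    (h₁ : L ≤ t) (h₂ : t < probe n B) : ¬ 2 ^ n ∣ t := by
  have hfB : probe n B < B := probe_lt (by omega)
  have hu := h.upper_le
  obtain ⟨a, ha⟩ := dvd_probe (n := n) (B := B)
  rintro ⟨c, rfl⟩
  rcases h.fat with h' | ⟨-, h'⟩
  · have hca : c < a := by
      rw [ha] at h₂; exact lt_of_mul_lt_mul_left h₂ (Nat.zero_le _)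
    have hc1 : 2 ^ n * c ≤ 2 ^ n * (a - 1) := Nat.mul_le_mul_left _ (by omega)
    have hc2 : 2 ^ n * (a - 1) ≤ 2 ^ n * a := Nat.mul_le_mul_left _ (by omega)
    rcases Nat.even_or_odd' a with ⟨b, hb | hb⟩
    · exact h' _ hLf hfB ⟨b, by rw [ha, hb, pow_succ]; ring⟩
    · exact h' (2 ^ n * (a - 1)) (by omega) (by omega)
        ⟨b, by rw [hb, Nat.add_sub_cancel, pow_succ]; ring⟩
  -- In the initial state the probe is at length `0`, and the empty string is stored, so a miss is
  -- impossible.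
  · rw [pow_succ, Nat.mul_div_cancel _ two_pos] at h'
    have ha0 : a = 0 := by
      by_contra hne
      have := Nat.mul_le_mul_left (2 ^ n) (Nat.one_le_iff_ne_zero.2 hne)
      omega
    refine hs ?_
    rw [ha, ha0]
    exact nil_mem_stored hq

/-- The key step of fat binary search. The handle of the edge of the probed prefix has a length
divisible by `2 ^ n`. If this length were below `B`, it would equal the probe, and the probe would
have hit. So the edge extends to `B`, or to the end of `q`, and is the edge of `q`. -/
theorem miss (hs : q.take (probe n B) ∉ stored D) (hLf : L ≤ probe n B) :
    SearchInv D q n L (probe n B) := by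
  have hfB : probe n B < B := probe_lt (by omega)
  have hu := h.upper_le
  have hgap := fun t => not_dvd_of_miss hq h hLB hs hLf (t := t)
  refine ⟨h.le_length, h.mem_stored, by omega, fun _ => ?_, fun _ => h.head hLB,
    .inl fun t => hgap t⟩
  have hqf := mem_prefixes_of_prefix (q.take_prefix (probe n B)) hq
  have hex : ∃ s, withPrefix D (q.take s) = withPrefix D (q.take (probe n B)) := ⟨_, rfl⟩
  classical
  -- The length at which the edge of the probed prefix starts. It is at least `L`, since `L` is
  -- itself the start of an edge.
  set s := Nat.find hex with hs_def
  have hsE : withPrefix D (q.take s) = withPrefix D (q.take (probe n B)) := Nat.find_spec hex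
  have hmin : ∀ j < s, withPrefix D (q.take j) ≠ withPrefix D (q.take (probe n B)) :=
    fun j hj => Nat.find_min hex hj
  have hsf : s ≤ probe n B := Nat.find_min' hex rfl
  have hLs : L ≤ s := by
    by_contra hlt
    rcases h.head hLB with h0 | hne
    · omega
    · have hle : probe n B ≤ extentLength D (q.take s) :=
        (withPrefix_take_eq_iff hq hsf (by omega)).1 hsE.symm
      have hE : ∀ j, s ≤ j → j ≤ L → withPrefix D (q.take j) = withPrefix D (q.take s) :=
        fun j h₁ h₂ => (withPrefix_take_eq_iff hq h₁ (by omega)).2 (by omega)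
      exact hne ((hE _ (by omega) (by omega)).trans (hE _ (by omega) le_rfl).symm)
  have hqs := mem_prefixes_of_prefix (q.take_prefix s) hq
  have hhead : q.take s ∈ heads D := by
    refine mem_heads.2 ⟨hqs, ?_⟩
    rcases Nat.eq_zero_or_pos s with h0 | h0
    · left; simp [h0]
    · right
      rw [dropLast_take_of_le (by omega), hsE]
      exact (hmin _ (by omega)).symm
  obtain ⟨hg₁, hg₂, hg₃, hg₄⟩ := isHandle_handle hqs
  have hgs : handle D (q.take s) ∈ stored D :=
    Finset.mem_union_right _ (Finset.mem_image_of_mem _ hhead)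
  set g := handle D (q.take s) with hg
  have hls : (q.take s).length = s := by simp; omega
  rw [hls] at hg₃ hg₄
  have hex : extentLength D (q.take s) = extentLength D (q.take (probe n B)) :=
    extentLength_congr hsE
  have hfe : probe n B ≤ extentLength D (q.take s) :=
    (withPrefix_take_eq_iff hq hsf (by omega)).1 hsE.symm
  have hdvd : 2 ^ n ∣ g.length := hg₄ _ hsf hfe _ dvd_probe
  have hqg : withPrefix D q ⊆ withPrefix D g := by
    rw [hg₂]; exact withPrefix_anti (q.take_prefix s)
  have htot := prefix_total_of_withPrefix_subset hq hqg
  -- The handle is comparable with `q`, so a handle shorter than `B` would be a prefix of `q` whose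
  -- length is a multiple of `2 ^ n` in `[L, B)`.
  have hgB : B ≤ g.length := by
    by_contra hlt
    have hgf := le_probe (B := B) (by omega) hdvd
    have hgq : g = q.take g.length := by
      rcases htot with h' | h'
      · exact List.prefix_iff_eq_take.1 h'
      · have h'' := h'.length_le
        rw [← h'.eq_of_length (by omega), List.take_length]
    rcases hgf.lt_or_eq with hlt' | heq
    · exact hgap _ (by omega) hlt' hdvd
    · rw [heq] at hgq
      exact hs (hgq ▸ hgs)
  have hge : g.length ≤ extentLength D (q.take (probe n B)) := by
    rw [← hex]; exact length_le_extentLength hg₁ hg₂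
  rcases hu.lt_or_eq with hlt | heq
  · rw [← h.upper (by omega)]
    exact ((withPrefix_take_eq_iff hq hfB.le (by omega)).2 (by omega)).symm
  · have := (withPrefix_take_eq_iff hq (i := probe n B) (j := q.length) (by omega) le_rfl).2
      (by omega)
    rw [List.take_length] at this
    exact this.symm

end SearchInv

end trie

/-! ## Fingerprints -/

/-- The Karp–Rabin fingerprint of a string. -/
def fingerprint (p b : ℕ) (u : List ℕ) : ℕ :=
  u.foldl (fun z c => (z * b + c) % p) 0

namespace fingerprint

open Polynomial

variable {p b : ℕ}

@[simp] theorem nil : fingerprint p b [] = 0 := rfl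

theorem concat (u : List ℕ) (c : ℕ) :
    fingerprint p b (u ++ [c]) = (fingerprint p b u * b + c) % p := by
  simp [fingerprint]

theorem lt (hp : 0 < p) (u : List ℕ) : fingerprint p b u < p := by
  induction u using List.reverseRecOn with
  | nil => simpa using hp
  | append_singleton u c _ => rw [concat]; exact Nat.mod_lt _ hp

theorem append_modEq (u v : List ℕ) :
    fingerprint p b (u ++ v) ≡ fingerprint p b u * b ^ v.length + fingerprint p b v [MOD p] := by
  induction v using List.reverseRecOn with
  | nil => simp; rfl
  | append_singleton v c ih =>
    rw [← List.append_assoc, concat, concat]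
    refine (Nat.mod_modEq _ _).trans ?_
    refine (((ih.mul_right b).add_right c)).trans ?_
    rw [List.length_append, List.length_singleton, pow_succ, add_mul, mul_assoc, add_assoc]
    exact Nat.ModEq.add_left _ (Nat.mod_modEq _ _).symm

/-- The fingerprint of a substring from those of two prefixes. -/
theorem of_append (hp : 0 < p) (u v : List ℕ) :
    (fingerprint p b (u ++ v) + (p - fingerprint p b u * (b ^ v.length % p) % p)) % p =
      fingerprint p b v := by
  have h := append_modEq (p := p) (b := b) u v
  set x := fingerprint p b u * (b ^ v.length % p) % p with hx
  have hxp : x < p := Nat.mod_lt _ hp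
  have hx' : x ≡ fingerprint p b u * b ^ v.length [MOD p] :=
    (Nat.mod_modEq _ _).trans (Nat.ModEq.mul_left _ (Nat.mod_modEq _ _))
  rw [← Nat.mod_eq_of_lt (lt hp v)]
  refine Nat.ModEq.add_right_cancel' x ?_
  rw [add_assoc, Nat.sub_add_cancel hxp.le]
  refine (Nat.add_modEq_right).trans (h.trans ?_)
  rw [add_comm]
  exact Nat.ModEq.add_left _ hx'.symm

/-! ### Choice of a base without collisions. -/

/-- The polynomial whose value at `b` is the fingerprint. -/
noncomputable def poly (p : ℕ) (u : List ℕ) : (ZMod p)[X] :=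
  u.foldl (fun z c => z * X + C (c : ZMod p)) 0

theorem poly_concat (u : List ℕ) (c : ℕ) : poly p (u ++ [c]) = poly p u * X + C (c : ZMod p) := by
  simp [poly]

theorem eval_poly (u : List ℕ) : (poly p u).eval (b : ZMod p) = (fingerprint p b u : ZMod p) := by
  induction u using List.reverseRecOn with
  | nil => simp [poly]
  | append_singleton u c ih => rw [poly_concat, concat]; simp [ih]

theorem natDegree_poly_le (u : List ℕ) : (poly p u).natDegree ≤ u.length := by
  induction u using List.reverseRecOn with
  | nil => simp [poly]
  | append_singleton u c ih =>
    rw [poly_concat, List.length_append, List.length_singleton]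
    refine (natDegree_add_C).le.trans ((natDegree_mul_le).trans ?_)
    exact Nat.add_le_add ih natDegree_X_le

/-- The constant coefficient recovers the last letter because letters are below `p`. Letters are
also nonzero modulo `p`, so strings of different lengths cannot agree through leading zeros. -/
theorem poly_injective {N : ℕ} (hN : N < p) {u v : List ℕ} (hu : IsStringOver N u)
    (hv : IsStringOver N v) (h : poly p u = poly p v) : u = v := by
  have hcast : ∀ c d : ℕ, c ≤ N → d ≤ N → (c : ZMod p) = (d : ZMod p) → c = d := by
    intro c d hc hd h
    rw [ZMod.natCast_eq_natCast_iff', Nat.mod_eq_of_lt (by omega), Nat.mod_eq_of_lt (by omega)] at h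
    exact h
  have hcoeff : ∀ (u : List ℕ) (c : ℕ), (poly p (u ++ [c])).coeff 0 = c := by
    intro u c; rw [poly_concat]; simp
  induction u using List.reverseRecOn generalizing v with
  | nil =>
    rcases List.eq_nil_or_concat' v with rfl | ⟨v, d, rfl⟩
    · rfl
    · have hd := hv d (by simp)
      have h0 := hcoeff v d
      rw [← h] at h0
      have := hcast 0 d (by omega) hd.2 (by simpa [poly] using h0)
      omega
  | append_singleton u c ih =>
    have hc := hu c (by simp)
    rcases List.eq_nil_or_concat' v with rfl | ⟨v, d, rfl⟩
    · have h0 := hcoeff u c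
      rw [h] at h0
      have := hcast 0 c (by omega) hc.2 (by simpa [poly] using h0)
      omega
    · have hd := hv d (by simp)
      have h0 := hcoeff u c
      rw [h, hcoeff] at h0
      obtain rfl := hcast d c hd.2 hc.2 h0
      rw [poly_concat, poly_concat] at h
      have h' : poly p u = poly p v := by
        have h'' := add_right_cancel h
        ext i
        have := congrArg (fun f => f.coeff (i + 1)) h''
        simpa using this
      rw [ih (fun c hc => hu c (by simp [hc])) (fun c hc => hv c (by simp [hc])) h']

/-- For a large prime modulus, some base distinguishes all strings of a given set. -/
theorem exists_base (hp : p.Prime) {N : ℕ} (S : Finset (List ℕ)) (hNp : N < p)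
    (hS : ∀ u ∈ S, u.length ≤ N ∧ IsStringOver N u) (hcard : S.card * S.card * N < p) :
    ∃ b < p, Set.InjOn (fingerprint p b) S := by
  classical
  have := Fact.mk hp
  -- A base is bad if it is a root of the difference of two distinct polynomials. Each difference
  -- has degree at most `N`, so there are at most `S.card * S.card * N` bad bases, fewer than `p`.
  let bad : Finset (ZMod p) := (S ×ˢ S).biUnion (fun x =>
    if poly p x.1 = poly p x.2 then ∅ else (poly p x.1 - poly p x.2).roots.toFinset)
  have hbad : bad.card < (Finset.univ : Finset (ZMod p)).card := by
    rw [Finset.card_univ, ZMod.card]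
    refine lt_of_le_of_lt ?_ hcard
    rw [← Finset.card_product]
    refine Finset.card_biUnion_le_card_mul _ _ _ fun x hx => ?_
    rw [Finset.mem_product] at hx
    split_ifs with h
    · simp
    · refine (Multiset.toFinset_card_le _).trans ((card_roots' _).trans ?_)
      refine (natDegree_sub_le _ _).trans (max_le ?_ ?_)
      · exact (natDegree_poly_le _).trans (hS _ hx.1).1
      · exact (natDegree_poly_le _).trans (hS _ hx.2).1
  obtain ⟨β, -, hβ⟩ := Finset.exists_mem_notMem_of_card_lt_card hbad
  refine ⟨β.val, ZMod.val_lt β, fun u hu v hv huv => ?_⟩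
  refine poly_injective hNp (hS u hu).2 (hS v hv).2 ?_
  by_contra hne
  refine hβ (Finset.mem_biUnion.2 ⟨(u, v), Finset.mem_product.2 ⟨hu, hv⟩, ?_⟩)
  rw [if_neg hne, Multiset.mem_toFinset, mem_roots (sub_ne_zero.2 hne), IsRoot.def, eval_sub,
    sub_eq_zero]
  have h := congrArg (fun n : ℕ => (n : ZMod p)) huv
  simp only [← eval_poly] at h
  simpa using h

end fingerprint

/-! ## Perfect hashing -/

/-- The multiplicative hash functions `u ↦ (α u mod p) mod s`. -/
def mulHash (p s α u : ℕ) : ℕ := α * u % p % s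

/-- The ordered pairs of distinct elements of `K` that collide. -/
def collisions (K : Finset ℕ) (h : ℕ → ℕ) : Finset (ℕ × ℕ) :=
  K.offDiag.filter (fun x => h x.1 = h x.2)

theorem card_multiples (p s : ℕ) :
    s * ((Finset.Ico 1 p).filter (fun d => s ∣ d)).card ≤ p - 1 := by
  have : (Finset.Ico 1 p).filter (fun d => s ∣ d) = (Finset.Ioc 0 (p - 1)).filter (s ∣ ·) := by
    ext d; simp only [Finset.mem_filter, Finset.mem_Ico, Finset.mem_Ioc]; omega
  rw [this, Nat.Ioc_filter_dvd_card_eq_div]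
  exact Nat.mul_div_le _ _

/-- Two distinct keys collide for a fraction of at most `2 / s` of the multipliers. -/
theorem card_colliding_le {p s u v : ℕ} (hp : p.Prime) (hu : u < p) (hv : v < p)
    (huv : u ≠ v) :
    s * ((Finset.Ico 1 p).filter (fun α => mulHash p s α u = mulHash p s α v)).card ≤
      2 * (p - 1) := by
  wlog hlt : v < u generalizing u v
  · have := this hv hu huv.symm (by omega)
    simpa only [eq_comm] using this
  set A := (Finset.Ico 1 p).filter (fun α => mulHash p s α u = mulHash p s α v)
  set M := (Finset.Ico 1 p).filter (fun d => s ∣ d)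
  have hM : s * M.card ≤ p - 1 := card_multiples p s
  have hd : Nat.Coprime (u - v) p := 
    (Nat.coprime_of_lt_prime (by omega) (by omega) hp).symm
  -- Multiplication by the nonzero residue `u - v` maps the nonzero residues injectively to
  -- themselves. A collision constrains `f α` to few values.
  let f : ℕ → ℕ := fun α => α * (u - v) % p
  have hf : ∀ α ∈ Finset.Ico 1 p, 0 < f α ∧ f α < p := by
    intro α hα
    rw [Finset.mem_Ico] at hα
    refine ⟨Nat.pos_of_ne_zero fun h0 => ?_, Nat.mod_lt _ hp.pos⟩
    have h1 : p ∣ α := (Nat.Coprime.dvd_mul_right hd.symm).1 (Nat.dvd_of_mod_eq_zero h0)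
    exact absurd (Nat.le_of_dvd (by omega) h1) (by omega)
  have hinj : Set.InjOn f (Finset.Ico 1 p : Finset ℕ) := by
    intro α hα β hβ h
    simp only [Finset.coe_Ico, Set.mem_Ico] at hα hβ
    have h1 : α ≡ β [MOD p] := Nat.ModEq.cancel_right_of_coprime hd.symm h
    exact Nat.ModEq.eq_of_lt_of_lt h1 hα.2 hβ.2
  have hsub : A.image f ⊆ M ∪ M.image (fun d => p - d) := by
    intro d hd
    obtain ⟨α, hα, rfl⟩ := Finset.mem_image.1 hd
    obtain ⟨hα, heq⟩ := Finset.mem_filter.1 hα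
    have hfα := hf α hα
    have hx : α * u % p < p := Nat.mod_lt _ hp.pos
    have hy : α * v % p < p := Nat.mod_lt _ hp.pos
    have hsum : α * v % p + f α ≡ α * u % p [MOD p] := by
      refine (Nat.ModEq.add (Nat.mod_modEq _ _) (Nat.mod_modEq _ _)).trans ?_
      rw [← mul_add, Nat.add_sub_cancel' hlt.le]
      exact (Nat.mod_modEq _ _).symm
    rw [Finset.mem_union]
    unfold mulHash at heq
    set a := α * u % p
    set b := α * v % p
    set c := f α
    -- Without wrap-around the two hashed residues differ by `c`, with wrap-around by `p - c`;
    -- equality modulo `s` makes that difference a multiple of `s`. These two cases cost the factor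
    -- `2`.
    by_cases hc : b + c < p
    · left
      have : b + c = a := Nat.ModEq.eq_of_lt_of_lt hsum hc hx
      refine Finset.mem_filter.2 ⟨Finset.mem_Ico.2 hfα, ?_⟩
      have := (Nat.modEq_iff_dvd' (by omega)).1 (show b ≡ a [MOD s] from heq.symm)
      rwa [show a - b = c by omega] at this
    · right
      have : b + c - p = a := by
        refine Nat.ModEq.eq_of_lt_of_lt (Nat.ModEq.trans ?_ hsum) (by omega) hx
        nth_rw 2 [show b + c = b + c - p + p by omega]
        exact Nat.add_modEq_right.symm
      refine Finset.mem_image.2 ⟨p - c, Finset.mem_filter.2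
        ⟨Finset.mem_Ico.2 ⟨by omega, by omega⟩, ?_⟩, by omega⟩
      have := (Nat.modEq_iff_dvd' (by omega)).1 (show a ≡ b [MOD s] from heq)
      rwa [show b - a = p - c by omega] at this
  have hA : A.card ≤ M.card + M.card := by
    rw [← Finset.card_image_of_injOn (hinj.mono (Finset.coe_subset.2 (Finset.filter_subset _ _)))]
    exact (Finset.card_le_card hsub).trans ((Finset.card_union_le _ _).trans
      (Nat.add_le_add_left Finset.card_image_le _))
  calc s * A.card ≤ s * (M.card + M.card) := Nat.mul_le_mul_left _ hA
    _ = s * M.card + s * M.card := by ring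
    _ ≤ 2 * (p - 1) := by omega

/-- Some multiplier has few collisions. -/
theorem exists_few_collisions {p : ℕ} (hp : p.Prime) (s : ℕ) (K : Finset ℕ)
    (hK : ∀ u ∈ K, u < p) :
    ∃ α < p, s * (collisions K (mulHash p s α)).card ≤ 2 * K.offDiag.card := by
  by_contra! hcon
  -- Averaging: count the triples of a multiplier and a colliding pair in both orders.
  have h1 : ∑ α ∈ Finset.Ico 1 p, s * (collisions K (mulHash p s α)).card =
      ∑ x ∈ K.offDiag, s * ((Finset.Ico 1 p).filter
        (fun α => mulHash p s α x.1 = mulHash p s α x.2)).card := by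
    simp only [collisions, Finset.card_filter, ← Finset.mul_sum]
    rw [Finset.sum_comm]
  have h2 : ∑ x ∈ K.offDiag, s * ((Finset.Ico 1 p).filter
        (fun α => mulHash p s α x.1 = mulHash p s α x.2)).card ≤ K.offDiag.card * (2 * (p - 1)) := by
    refine (Finset.sum_le_card_nsmul _ _ (2 * (p - 1)) fun x hx => ?_)
    rw [Finset.mem_offDiag] at hx
    exact card_colliding_le hp (hK _ hx.1) (hK _ hx.2.1) hx.2.2
  have h3 : ∑ α ∈ Finset.Ico 1 p, 2 * K.offDiag.card <
      ∑ α ∈ Finset.Ico 1 p, s * (collisions K (mulHash p s α)).card := by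
    refine Finset.sum_lt_sum_of_nonempty ⟨1, Finset.mem_Ico.2 ⟨le_rfl, hp.one_lt⟩⟩ fun α hα => ?_
    exact hcon α (Finset.mem_Ico.1 hα).2
  rw [Finset.sum_const, Nat.card_Ico, smul_eq_mul, h1] at h3
  have : K.offDiag.card * (2 * (p - 1)) = (p - 1) * (2 * K.offDiag.card) := by ring
  omega

/-- With a table of more than `2 * K.card ^ 2` cells the bound on collisions drops below one. The `+
1` also keeps the table nonempty for an empty bucket. -/
theorem exists_injOn_mulHash {p : ℕ} (hp : p.Prime) (K : Finset ℕ) (hK : ∀ u ∈ K, u < p) :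
    ∃ α < p, Set.InjOn (mulHash p (2 * (K.card * K.card) + 1) α) K := by
  obtain ⟨α, hα, h⟩ := exists_few_collisions hp (2 * (K.card * K.card) + 1) K hK
  refine ⟨α, hα, fun u hu v hv huv => ?_⟩
  by_contra hne
  have hpos : 1 ≤ (collisions K (mulHash p (2 * (K.card * K.card) + 1) α)).card :=
    Finset.card_pos.2 ⟨(u, v), Finset.mem_filter.2 ⟨Finset.mem_offDiag.2 ⟨hu, hv, hne⟩, huv⟩⟩
  have hoff : K.offDiag.card ≤ K.card * K.card := by rw [Finset.offDiag_card]; omega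
  have := Nat.mul_le_mul_left (2 * (K.card * K.card) + 1) hpos
  omega

/-- The two-level scheme of Fredman, Komlós and Szemerédi: bucket `i` has multiplier `A i`, size
`Z i` and offset `F i`. -/
theorem exists_perfect_hash {p : ℕ} (hp : p.Prime) (K : Finset ℕ) (hK : ∀ u ∈ K, u < p)
    (hne : K.Nonempty) :
    ∃ (α N : ℕ) (A Z F : ℕ → ℕ), α < p ∧ N ≤ 7 * K.card ∧
      (∀ i < K.card, A i < p ∧ 0 < Z i ∧ F i + Z i ≤ N) ∧
      Set.InjOn (fun u => F (mulHash p K.card α u) +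
        mulHash p (Z (mulHash p K.card α u)) (A (mulHash p K.card α u)) u) K := by
  classical
  set s := K.card with hs
  have hs0 : 0 < s := Finset.card_pos.2 hne
  obtain ⟨α, hα, hcol⟩ := exists_few_collisions hp s K hK
  set g := mulHash p s α with hg
  have hgs : ∀ u, g u < s := fun u => Nat.mod_lt _ hs0
  let bucket : ℕ → Finset ℕ := fun i => K.filter (fun u => g u = i)
  have hbK : ∀ i, ∀ u ∈ bucket i, u < p := fun i u hu => hK u (Finset.mem_filter.1 hu).1
  choose A hA hinj using fun i => exists_injOn_mulHash hp (bucket i) (hbK i)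
  let Z : ℕ → ℕ := fun i => 2 * ((bucket i).card * (bucket i).card) + 1
  let F : ℕ → ℕ := fun i => ∑ j ∈ Finset.range i, Z j
  -- A sum of squared bucket sizes counts the colliding ordered pairs, at most `2 * s`, plus the `s`
  -- diagonal pairs. As a bucket of size `t` gets `2 * t ^ 2 + 1` cells, the total is at most `7 *
  -- s`.
  have hsum : ∑ i ∈ Finset.range s, (bucket i).card * (bucket i).card ≤ 3 * s := by
    have hcard : K.card = ∑ i ∈ Finset.range s, (bucket i).card :=
      Finset.card_eq_sum_card_fiberwise fun u _ => Finset.mem_coe.2 (Finset.mem_range.2 (hgs u))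
    have hcc : (collisions K g).card = ∑ i ∈ Finset.range s, (bucket i).offDiag.card := by
      rw [Finset.card_eq_sum_card_fiberwise (f := fun x : ℕ × ℕ => g x.1) (t := Finset.range s)
        fun u _ => Finset.mem_coe.2 (Finset.mem_range.2 (hgs _))]
      refine Finset.sum_congr rfl fun i _ => congrArg Finset.card ?_
      ext x
      simp only [collisions, bucket, Finset.mem_filter, Finset.mem_offDiag]
      constructor
      · rintro ⟨⟨⟨h1, h2, h3⟩, h4⟩, h5⟩
        exact ⟨⟨h1, h5⟩, ⟨h2, h4 ▸ h5⟩, h3⟩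
      · rintro ⟨⟨h1, h2⟩, ⟨h3, h4⟩, h5⟩
        exact ⟨⟨⟨h1, h3, h5⟩, h2.trans h4.symm⟩, h2⟩
    have hcc2 : (collisions K g).card ≤ 2 * s := by
      have hoff : K.offDiag.card ≤ s * s := by
        rw [Finset.offDiag_card]; exact Nat.sub_le _ _
      have : s * (collisions K g).card ≤ s * (2 * s) := by
        calc _ ≤ 2 * K.offDiag.card := hcol
          _ ≤ 2 * (s * s) := by omega
          _ = s * (2 * s) := by ring
      exact Nat.le_of_mul_le_mul_left this hs0
    calc ∑ i ∈ Finset.range s, (bucket i).card * (bucket i).card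
        = ∑ i ∈ Finset.range s, ((bucket i).offDiag.card + (bucket i).card) := by
          refine Finset.sum_congr rfl fun i _ => ?_
          rw [Finset.offDiag_card]
          have := Nat.le_mul_self (bucket i).card
          omega
      _ = (collisions K g).card + K.card := by rw [Finset.sum_add_distrib, ← hcc, ← hcard]
      _ ≤ 3 * s := by omega
  have hFmono : ∀ i j, i ≤ j → F i ≤ F j := fun i j hij =>
    Finset.sum_le_sum_of_subset (Finset.range_mono hij)
  have hFsucc : ∀ i, F (i + 1) = F i + Z i := fun i => Finset.sum_range_succ _ _
  refine ⟨α, F s, A, Z, F, hα, ?_, fun i hi => ⟨hA i, Nat.succ_pos _, ?_⟩, ?_⟩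
  · have : F s = 2 * ∑ i ∈ Finset.range s, (bucket i).card * (bucket i).card + s := by
      simp [F, Z, Finset.sum_add_distrib, Finset.mul_sum]
    omega
  · rw [← hFsucc]; exact hFmono _ _ hi
  · intro u hu v hv huv
    change F (g u) + mulHash p (Z (g u)) (A (g u)) u =
      F (g v) + mulHash p (Z (g v)) (A (g v)) v at huv
    have hu' : mulHash p (Z (g u)) (A (g u)) u < Z (g u) := Nat.mod_lt _ (Nat.succ_pos _)
    have hv' : mulHash p (Z (g v)) (A (g v)) v < Z (g v) := Nat.mod_lt _ (Nat.succ_pos _)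
    have h1 := hFsucc (g u)
    have h2 := hFsucc (g v)
    -- The cell ranges of different buckets are disjoint, because the offsets are partial sums of
    -- the sizes.
    have hguv : g u = g v := by
      by_contra hne
      rcases Nat.lt_or_gt_of_ne hne with h | h
      · have := hFmono _ _ h
        simp only [Nat.succ_eq_add_one] at this
        omega
      · have := hFmono _ _ h
        simp only [Nat.succ_eq_add_one] at this
        omega
    rw [← hguv] at huv
    refine hinj (g u) (Finset.mem_coe.2 (Finset.mem_filter.2 ⟨hu, rfl⟩))
      (Finset.mem_coe.2 (Finset.mem_filter.2 ⟨hv, hguv.symm⟩)) ?_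
    exact Nat.add_left_cancel huv

/-! ## The data structure -/

/-- A table of `T` records of four words. -/
structure PrefixIndex where
  p : ℕ
  b : ℕ
  T : ℕ
  fld : ℕ → ℕ → ℕ

namespace PrefixIndex

/-- The words of the table. -/
def words (X : PrefixIndex) : List ℕ :=
  (List.range (4 * X.T)).map (fun a => X.fld (a / 4) (a % 4))

theorem length_words (X : PrefixIndex) : X.words.length = 4 * X.T := by simp [words]

theorem getElem?_words (X : PrefixIndex) {R r : ℕ} (hR : R < X.T) (hr : r < 4) :
    X.words[4 * R + r]? = some (X.fld R r) := by
  have h1 : (4 * R + r) / 4 = R := by omega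
  have h2 : (4 * R + r) % 4 = r := by omega
  simp only [words, List.getElem?_map, List.getElem?_range (show 4 * R + r < 4 * X.T by omega),
    Option.map_some, h1, h2]

/-- One step of the two-level hash function, from the record `R`. -/
def next (X : PrefixIndex) (u R : ℕ) : ℕ :=
  X.fld R 2 + mulHash X.p (X.fld R 1) (X.fld R 0) u

/-- The record of the key `u`. -/
def slot (X : PrefixIndex) (u : ℕ) : ℕ := X.next u (X.next u 0)

/-- The fingerprint of a string. -/
def key (X : PrefixIndex) (u : List ℕ) : ℕ := fingerprint X.p X.b u

/-- The table is an index for the prefixes of the strings of `D`. -/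
structure IsIndexOf (X : PrefixIndex) (D : Finset (List ℕ)) : Prop where
  one_lt_p : 1 < X.p
  two_le_T : 2 ≤ X.T
  fld_le : ∀ R r, X.fld R r ≤ X.p
  fld_p : X.fld 1 0 = X.p
  fld_b : X.fld 1 1 = X.b
  bucket_lt : ∀ u, X.next u 0 < X.T
  slot_lt : ∀ u, X.slot u < X.T
  -- Required only for prefixes of strings of `D`; other strings may produce false matches, which is
  -- harmless.
  miss : ∀ u ∈ prefixes D, u ∉ stored D → X.fld (X.slot (X.key u)) 0 ≠ X.key u
  hit : ∀ u ∈ stored D, X.fld (X.slot (X.key u)) 0 = X.key u ∧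
    X.fld (X.slot (X.key u)) 1 = extentLength D u ∧
    X.fld (X.slot (X.key u)) 2 = loRank D u ∧
    X.fld (X.slot (X.key u)) 3 = hiRank D u

/-- The record with the given words. -/
def record (a b c d : ℕ) : ℕ → ℕ
  | 0 => a
  | 1 => b
  | 2 => c
  | _ => d

theorem record_le {a b c d m : ℕ} (ha : a ≤ m) (hb : b ≤ m) (hc : c ≤ m) (hd : d ≤ m) (r : ℕ) :
    record a b c d r ≤ m := by
  unfold record; split <;> assumption

theorem card_prefixes_le {D : Finset (List ℕ)} {N : ℕ} (hlen : ∀ s ∈ D, s.length ≤ N) :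
    (prefixes D).card ≤ D.card * (N + 1) := by
  refine Finset.card_biUnion_le_card_mul _ _ _ fun s hs => (List.toFinset_card_le _).trans ?_
  rw [List.length_inits]
  exact Nat.succ_le_succ (hlen s hs)

open Classical in
/-- The table with hash functions given by `α`, `s`, `A`, `Z`, `F`. -/
noncomputable def ofHash (D : Finset (List ℕ)) (p b α s n : ℕ) (A Z F : ℕ → ℕ) (σ : ℕ → ℕ) :
    PrefixIndex where
  p := p
  b := b
  T := 2 + s + n
  -- Record `0` has the shape of a bucket record and describes the top-level hash function, so both
  -- levels run the same code. Record `1` holds the modulus and the base, then come the `s` buckets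
  -- and the `n` cells. Empty cells contain `p`, which is never a fingerprint.
  fld R := if R = 0 then record α s 2 0 else if R = 1 then record p b 0 0 else
    if R < 2 + s then record (A (R - 2)) (Z (R - 2)) (2 + s + F (R - 2)) 0 else
    if h : ∃ u ∈ stored D, σ (fingerprint p b u) = R - (2 + s) then
      record (fingerprint p b h.choose) (extentLength D h.choose) (loRank D h.choose)
        (hiRank D h.choose)
    else record p 0 0 0

/-- With at most `4 * D.card` keys and `28 * D.card` cells, two header records give the bound `34 *
D.card`. -/
theorem exists_isIndexOf {D : Finset (List ℕ)} {N : ℕ} (hD : D.Nonempty) (hcard : D.card ≤ N)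
    (hstr : ∀ s ∈ D, s.length ≤ N ∧ IsStringOver N s) :
    ∃ X : PrefixIndex, X.IsIndexOf D ∧ X.p ≤ 68 * N ^ 5 ∧ N ≤ X.p ∧ X.T ≤ 34 * D.card := by
  classical
  have hD1 : 1 ≤ D.card := Finset.card_pos.2 hD
  have hN1 : 1 ≤ N := hD1.trans hcard
  -- The modulus must exceed `4 * N ^ 5` for the choice of the base; the factor `34` makes every
  -- table entry, in particular every record number, at most `p`.
  obtain ⟨p, hp, hlt, hle⟩ := Nat.exists_prime_lt_and_le_two_mul (34 * N ^ 5) (by positivity)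
  have hNpow : N ≤ N ^ 5 := Nat.le_self_pow (by norm_num) N
  have hstr' : ∀ u ∈ prefixes D, u.length ≤ N ∧ IsStringOver N u := by
    intro u hu
    obtain ⟨s, hs, hus⟩ := mem_prefixes.1 hu
    exact ⟨hus.length_le.trans (hstr s hs).1, fun c hc => (hstr s hs).2 c (hus.subset hc)⟩
  have hpc : (prefixes D).card ≤ 2 * N ^ 2 :=
    calc (prefixes D).card ≤ D.card * (N + 1) := card_prefixes_le fun s hs => (hstr s hs).1
      _ ≤ N * (N + N) := Nat.mul_le_mul hcard (by omega)
      _ = 2 * N ^ 2 := by ring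
  have hpc2 : (prefixes D).card * (prefixes D).card * N < p :=
    calc (prefixes D).card * (prefixes D).card * N ≤ 2 * N ^ 2 * (2 * N ^ 2) * N := by gcongr
      _ = 4 * N ^ 5 := by ring
      _ < p := by omega
  obtain ⟨b, hb, hinj⟩ := fingerprint.exists_base hp (prefixes D) (by omega) hstr' hpc2
  obtain ⟨d, hd⟩ := hD
  have hne : ((stored D).image (fingerprint p b)).Nonempty :=
    ⟨_, Finset.mem_image_of_mem _ (SearchInv.nil_mem_stored (mem_prefixes.2 ⟨d, hd, d.prefix_refl⟩))⟩
  set K := (stored D).image (fingerprint p b) with hK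
  have hKp : ∀ u ∈ K, u < p := by
    intro u hu
    obtain ⟨v, -, rfl⟩ := Finset.mem_image.1 hu
    exact fingerprint.lt hp.pos v
  have hKc : K.card ≤ 4 * D.card := Finset.card_image_le.trans card_stored_le
  have hK0 : 0 < K.card := Finset.card_pos.2 hne
  obtain ⟨α, n, A, Z, F, hα, hn, hAZF, hFKS⟩ := exists_perfect_hash hp K hKp hne
  set s := K.card with hs
  set g : ℕ → ℕ := mulHash p s α with hg
  set σ : ℕ → ℕ := fun u => F (g u) + mulHash p (Z (g u)) (A (g u)) u with hσ
  have hgs : ∀ u, g u < s := fun u => Nat.mod_lt _ hK0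
  have hσn : ∀ u, σ u < n := by
    intro u
    have h1 := hAZF _ (hgs u)
    have h2 : mulHash p (Z (g u)) (A (g u)) u < Z (g u) := Nat.mod_lt _ h1.2.1
    simp only [hσ]; omega
  let X := ofHash D p b α s n A Z F σ
  have hnext : ∀ u, X.next u 0 = 2 + g u := by
    intro u
    simp [next, X, ofHash, record, hg]
  have hslot : ∀ u, X.slot u = 2 + s + σ u := by
    intro u
    have := hgs u
    rw [slot, hnext]
    simp only [next, X, ofHash]
    rw [if_neg (by omega), if_neg (by omega), if_pos (by omega)]
    simp [hσ, record, add_assoc]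
  have hfld : ∀ u, X.fld (X.slot u) = if h : ∃ v ∈ stored D, σ (fingerprint p b v) = σ u then
      record (fingerprint p b h.choose) (extentLength D h.choose) (loRank D h.choose)
        (hiRank D h.choose)
    else record p 0 0 0 := by
    intro u
    rw [hslot]
    simp only [X, ofHash]
    rw [if_neg (by omega), if_neg (by omega), if_neg (by omega), Nat.add_sub_cancel_left]
  have hσinj : ∀ u ∈ stored D, ∀ v ∈ stored D,
      σ (fingerprint p b u) = σ (fingerprint p b v) → u = v := by
    intro u hu v hv h
    exact hinj (stored_subset_prefixes hu) (stored_subset_prefixes hv)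
      (hFKS (Finset.mem_image_of_mem _ hu) (Finset.mem_image_of_mem _ hv) h)
  have hext : ∀ u, extentLength D u ≤ N := fun u => Finset.sup_le fun v hv =>
    (hstr' v (Finset.mem_filter.1 hv).1).1
  have hlo : ∀ u, loRank D u ≤ D.card := fun u => loRank_le_card
  have hhi : ∀ u, hiRank D u ≤ D.card := fun u => hiRank_le_card
  refine ⟨X, ⟨hp.one_lt, ?_, ?_, ?_, ?_, ?_, ?_, ?_, ?_⟩, by simp only [X, ofHash]; omega,
    by simp only [X, ofHash]; omega, ?_⟩
  · simp only [X, ofHash]; omega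
  · intro R r
    simp only [X, ofHash]
    split_ifs with h0 h1 h2 h3
    · exact record_le hα.le (by omega) (by omega) (by omega) r
    · exact record_le le_rfl hb.le (by omega) (by omega) r
    · have := hAZF (R - 2) (by omega)
      exact record_le this.1.le (by omega) (by omega) (by omega) r
    · have h4 := hext h3.choose
      have h5 := hlo h3.choose
      have h6 := hhi h3.choose
      exact record_le (fingerprint.lt hp.pos _).le (by omega) (by omega) (by omega) r
    · exact record_le le_rfl (by omega) (by omega) (by omega) r
  · simp [X, ofHash, record]
  · simp [X, ofHash, record]
  · intro u
    have := hgs u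
    rw [hnext]; simp only [X, ofHash]; omega
  · intro u
    have := hσn u
    rw [hslot]; simp only [X, ofHash]; omega
  · intro u hu hus
    have hkey : X.key u = fingerprint p b u := rfl
    rw [hfld, hkey]
    split_ifs with h
    · intro heq
      obtain ⟨h1, -⟩ := h.choose_spec
      refine hus ?_
      rw [← hinj (stored_subset_prefixes h1) hu heq]
      exact h1
    · exact (fingerprint.lt hp.pos u).ne'
  · intro u hu
    have hkey : X.key u = fingerprint p b u := rfl
    have h : ∃ v ∈ stored D, σ (fingerprint p b v) = σ (fingerprint p b u) := ⟨u, hu, rfl⟩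
    have hch : h.choose = u := hσinj _ h.choose_spec.1 _ hu h.choose_spec.2
    rw [hfld, hkey, dif_pos h, hch]
    exact ⟨rfl, rfl, rfl, rfl⟩
  · simp only [X, ofHash]; omega

end PrefixIndex

/-! ## The query program

Registers: `5` and `6` hold `1` and `4`, `7` and `8` the modulus and the base of the fingerprints,
`9` and `10` the addresses of the fingerprints of the prefixes of the pattern and of the powers of
the base, `11` a power of two above the length of the pattern, `12` holds `0`, `13` and `14` the
addresses of the current query and of its answer, `15` and `16` the current offset and length,
`17`, `18`, `19` and `20` the variables `L`, `B`, `2 ^ n` and `f` of the search, `21` a key, and `22`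
its record. -/

namespace RamProg

/-- One step of the two-level hash function. -/
def hashStep : RamProg := block
  [op .mul 23 22 6, load 24 23, op .mul 24 24 21, op .mod 24 24 7, op .add 23 23 5, load 25 23,
    op .mod 24 24 25, op .add 23 23 5, load 25 23, op .add 22 25 24]

/-- The fingerprint of the substring of length `reg 20` at the current offset. -/
def substringKey : RamProg := block
  [op .add 23 9 15, load 23 23, op .add 24 10 20, load 24 24, op .mul 23 23 24, op .mod 23 23 7,
    op .sub 23 7 23, op .add 24 15 20, op .add 24 9 24, load 24 24, op .add 24 24 23,
    op .mod 21 24 7, const 22 0]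

/-- Finds the address of the record of the substring of length `reg 20` at the current offset. -/
def locate : RamProg :=
  seq substringKey (seq hashStep (seq hashStep (op .mul 22 22 6)))

/-- Narrows the search interval according to the located record. -/
def narrow : RamProg :=
  seq (load 23 22) (ite (.eq 23 21)
    (seq (block [op .add 23 22 5, load 23 23])
      (ite (.lt 23 16) (op .add 17 23 5) (block [move 17 20, move 18 20])))
    (move 18 20))

/-- One probe of the search. -/
def searchProbe : RamProg :=
  ite (.lt 17 18)
    (seq (block [op .sub 23 18 5, op .mod 24 23 19, op .sub 20 23 24])
      (ite (.le 17 20) (seq locate narrow) skip))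
    skip

/-- One round of the search. -/
def searchRound : RamProg :=
  seq searchProbe (block [const 23 2, op .div 19 19 23])

/-- Reads and answers the current query. -/
def answerQuery : RamProg :=
  seq (block [load 15 13, op .add 13 13 5, load 16 13, op .add 13 13 5, const 17 0,
      op .add 18 16 5, move 19 11])
    (seq (loop (.ne 19 12) searchRound)
      (seq (move 20 17)
        (seq locate
          (block [op .add 22 22 5, op .add 22 22 5, load 23 22, op .add 22 22 5, load 24 22,
            store 14 23, op .add 14 14 5, store 14 24, op .add 14 14 5]))))

/-- Extends the tables of fingerprints and powers by one entry. -/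
def tableStep : RamProg := block
  [op .add 23 0 13, load 23 23, op .mul 21 21 8, op .add 21 21 23, op .mod 21 21 7,
    op .mul 22 22 8, op .mod 22 22 7, op .add 13 13 5, op .add 23 9 13, store 23 21,
    op .add 23 10 13, store 23 22]

/-- The query program. -/
def query : RamProg :=
  seq (block [const 5 1, const 6 4, const 12 0, load 7 6, op .add 23 6 5, load 8 23,
      op .add 9 3 3, op .add 9 9 4, op .add 10 9 1, op .add 10 10 5,
      const 13 0, const 21 0, const 22 1, store 9 21, store 10 22])
    (seq (loop (.lt 13 1) tableStep)
      (seq (move 11 5)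
        (seq (loop (.le 11 1) (op .add 11 11 11))
          (seq (block [move 13 2, move 14 4])
            (loop (.lt 13 4) answerQuery)))))

end RamProg

open RamProg

/-! ### Word arithmetic without overflow, and record lookup. -/

theorem RamOp.eval_add {w a b : ℕ} (h : a + b < 2 ^ w) : RamOp.add.eval w a b = a + b :=
  Nat.mod_eq_of_lt h

theorem RamOp.eval_mul {w a b : ℕ} (h : a * b < 2 ^ w) : RamOp.mul.eval w a b = a * b :=
  Nat.mod_eq_of_lt h

theorem RamOp.eval_sub {w a b : ℕ} (ha : a < 2 ^ w) (hb : b ≤ a) :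
    RamOp.sub.eval w a b = a - b := by
  show (a + (2 ^ w - b)) % 2 ^ w = a - b
  rw [show a + (2 ^ w - b) = a - b + 2 ^ w by omega, Nat.add_mod_right,
    Nat.mod_eq_of_lt (by omega)]

/-- The state of the machine while queries are answered. -/
structure Ready (w : ℕ) (X : PrefixIndex) (P : List ℕ) (σ : RamState) : Prop where
  p_mul_p : X.p * X.p < 2 ^ w
  table_lt : 4 * X.T < 2 ^ w
  one : σ.reg 5 = 1
  four : σ.reg 6 = 4
  modulus : σ.reg 7 = X.p
  zero : σ.reg 12 = 0
  table : ∀ R < X.T, ∀ r < 4, σ.mem (4 * R + r) = X.fld R r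
  hashes_lt : σ.reg 9 + P.length + 1 < 2 ^ w
  hashes : ∀ j ≤ P.length, σ.mem (σ.reg 9 + j) = X.key (P.take j)
  powers_lt : σ.reg 10 + P.length < 2 ^ w
  powers : ∀ j ≤ P.length, σ.mem (σ.reg 10 + j) = X.b ^ j % X.p

namespace Ready

variable {w : ℕ} {X : PrefixIndex} {D : Finset (List ℕ)} {P : List ℕ} {σ σ' : RamState}

theorem congr (h : Ready w X P σ) (hm : σ'.mem = σ.mem) (hr : ∀ i < 13, σ'.reg i = σ.reg i) :
    Ready w X P σ' := by
  obtain ⟨h1, h2, h3, h4, h5, h6, h7, h8, h9, h10, h11⟩ := h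
  constructor <;> (try rw [hm]) <;> (try rw [hr _ (by norm_num)]) <;> assumption

/-- Multipliers and keys are at most `p`, so the product fits into a word because `p * p` does. -/
theorem hashStep_reg (h : Ready w X P σ) (hX : X.IsIndexOf D) {u : ℕ} (hu : σ.reg 21 = u)
    (hup : u < X.p) (hR : σ.reg 22 < X.T) (hlt : X.next u (σ.reg 22) < X.T) :
    (hashStep.run w σ).reg 22 = X.next u (σ.reg 22) := by
  obtain ⟨R, hR'⟩ : ∃ R, R = σ.reg 22 := ⟨_, rfl⟩
  rw [← hR'] at hR hlt ⊢
  have hp := h.p_mul_p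
  have hT := h.table_lt
  have e1 : RamOp.mul.eval w R 4 = 4 * R := by
    rw [RamOp.eval_mul (by omega), mul_comm]
  have e2 : RamOp.add.eval w (4 * R) 1 = 4 * R + 1 := RamOp.eval_add (by omega)
  have e3 : RamOp.add.eval w (4 * R + 1) 1 = 4 * R + 2 := RamOp.eval_add (by omega)
  have e4 : RamOp.mul.eval w (X.fld R 0) u = X.fld R 0 * u :=
    RamOp.eval_mul ((Nat.mul_le_mul (hX.fld_le R 0) hup.le).trans_lt hp)
  have e5 : RamOp.add.eval w (X.fld R 2) (X.fld R 0 * u % X.p % X.fld R 1) = X.next u R :=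
    RamOp.eval_add (lt_of_lt_of_le hlt (by omega))
  have m0 : σ.mem (4 * R) = X.fld R 0 := h.table R hR 0 (by norm_num)
  have m1 := h.table R hR 1 (by norm_num)
  have m2 := h.table R hR 2 (by norm_num)
  simp [hashStep, block, run, h.one, h.four, h.modulus, hu, ← hR', e1, e2, e3, m0, m1, m2, e4]
  exact e5

/-- Combines two tabulated prefix fingerprints and one power as in `fingerprint.of_append`; adding
`p` minus the product avoids negative numbers. -/
theorem substringKey_reg (h : Ready w X P σ) (hX : X.IsIndexOf D) {o f : ℕ} (ho : σ.reg 15 = o)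
    (hf : σ.reg 20 = f) (hof : o + f ≤ P.length) :
    (substringKey.run w σ).reg 21 = X.key ((P.drop o).take f) ∧
      (substringKey.run w σ).reg 22 = 0 := by
  have hp := h.p_mul_p
  have hp1 := hX.one_lt_p
  have hpp : X.p + X.p ≤ X.p * X.p := by nlinarith
  have h9 := h.hashes_lt
  have h10 := h.powers_lt
  have hk : ∀ u, X.key u < X.p := fun u => fingerprint.lt (by omega) u
  have hb : X.b ^ f % X.p < X.p := Nat.mod_lt _ (by omega)
  have hx : X.key (P.take o) * (X.b ^ f % X.p) % X.p < X.p := Nat.mod_lt _ (by omega)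
  have e1 : RamOp.add.eval w (σ.reg 9) o = σ.reg 9 + o := RamOp.eval_add (by omega)
  have e2 : RamOp.add.eval w (σ.reg 10) f = σ.reg 10 + f := RamOp.eval_add (by omega)
  have e3 : RamOp.mul.eval w (X.key (P.take o)) (X.b ^ f % X.p) =
      X.key (P.take o) * (X.b ^ f % X.p) :=
    RamOp.eval_mul ((Nat.mul_le_mul (hk _).le hb.le).trans_lt hp)
  have e4 : RamOp.sub.eval w X.p (X.key (P.take o) * (X.b ^ f % X.p) % X.p) =
      X.p - X.key (P.take o) * (X.b ^ f % X.p) % X.p := RamOp.eval_sub (by omega) hx.le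
  have e5 : RamOp.add.eval w o f = o + f := RamOp.eval_add (by omega)
  have e6 : RamOp.add.eval w (σ.reg 9) (o + f) = σ.reg 9 + (o + f) := RamOp.eval_add (by omega)
  have e7 : RamOp.add.eval w (X.key (P.take (o + f)))
      (X.p - X.key (P.take o) * (X.b ^ f % X.p) % X.p) = X.key (P.take (o + f)) +
      (X.p - X.key (P.take o) * (X.b ^ f % X.p) % X.p) := by
    have := hk (P.take (o + f))
    exact RamOp.eval_add (by omega)
  have hr : RamOp.mod.eval w = fun a b => a % b := rfl
  have hlen : ((P.drop o).take f).length = f := by simp; omega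
  have happ := fingerprint.of_append (p := X.p) (b := X.b) (by omega) (P.take o)
    ((P.drop o).take f)
  rw [← List.take_add, hlen] at happ
  constructor
  · simp [-Nat.mul_mod_mod, substringKey, block, run, h.modulus, ho, hf, e1, e2, e3, e4, e5, e6, h.hashes o (by omega),
      h.hashes _ hof, h.powers f (by omega), hr, e7]
    exact happ
  · simp [substringKey, block, run]

/-- Two hash steps lead from the header record to the bucket and then to the cell; the final factor
`4` turns a record number into an address. -/
theorem locate_reg (h : Ready w X P σ) (hX : X.IsIndexOf D) {o f : ℕ} (ho : σ.reg 15 = o)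
    (hf : σ.reg 20 = f) (hof : o + f ≤ P.length) :
    (locate.run w σ).reg 21 = X.key ((P.drop o).take f) ∧
      (locate.run w σ).reg 22 = 4 * X.slot (X.key ((P.drop o).take f)) := by
  set u := X.key ((P.drop o).take f) with hu
  have hT := h.table_lt
  have hup : u < X.p := fingerprint.lt (by have := hX.one_lt_p; omega) _
  have s1 : substringKey.IsStraight := by simp [substringKey, block, IsStraight]
  have s2 : hashStep.IsStraight := by simp [hashStep, block, IsStraight]
  have r1 : substringKey.ReadOnly := by simp [substringKey, block, ReadOnly]
  have r2 : hashStep.ReadOnly := by simp [hashStep, block, ReadOnly]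
  have k1 : ∀ i < 13, substringKey.Keeps i := fun i hi => by
    simp [substringKey, block, Keeps]; omega
  have k2 : ∀ i < 22, hashStep.Keeps i := fun i hi => by simp [hashStep, block, Keeps]; omega
  obtain ⟨a1, a2⟩ := h.substringKey_reg hX ho hf hof
  set σ₁ := substringKey.run w σ
  have h1 : Ready w X P σ₁ := h.congr (s1.run_mem r1) fun i hi => s1.run_reg (k1 i hi)
  have b1 := h1.hashStep_reg hX a1 hup (by rw [a2]; have := hX.two_le_T; omega)
    (by rw [a2]; exact hX.bucket_lt _)
  have b2 : (hashStep.run w σ₁).reg 21 = u := (s2.run_reg (k2 21 (by norm_num))).trans a1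
  set σ₂ := hashStep.run w σ₁
  rw [a2] at b1
  have h2 : Ready w X P σ₂ := h1.congr (s2.run_mem r2) fun i hi => s2.run_reg (k2 i (by omega))
  have c1 := h2.hashStep_reg hX b2 hup (by rw [b1]; exact hX.bucket_lt _)
    (by rw [b1]; exact hX.slot_lt _)
  have c2 : (hashStep.run w σ₂).reg 21 = u := (s2.run_reg (k2 21 (by norm_num))).trans b2
  set σ₃ := hashStep.run w σ₂
  have h3 : Ready w X P σ₃ := h2.congr (s2.run_mem r2) fun i hi => s2.run_reg (k2 i (by omega))
  rw [b1] at c1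
  change σ₃.reg 22 = X.slot u at c1
  have hrun : locate.run w σ = (op .mul 22 22 6).run w σ₃ := rfl
  have := hX.slot_lt u
  rw [hrun]
  constructor
  · simp [run, c2]
  · simp only [run, c1, h3.four, RamState.setReg_reg, if_pos]
    rw [RamOp.eval_mul (by omega), mul_comm]

theorem locate_isStraight : locate.IsStraight := by
  simp [locate, substringKey, hashStep, block, IsStraight]

theorem locate_readOnly : locate.ReadOnly := by
  simp [locate, substringKey, hashStep, block, ReadOnly]

theorem locate_keeps {i : ℕ} (hi : i < 21) : locate.Keeps i := by
  simp [locate, substringKey, hashStep, block, Keeps]; omega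

theorem halts_locate (h : Ready w X P σ) (hX : X.IsIndexOf D) {o f : ℕ} (ho : σ.reg 15 = o)
    (hf : σ.reg 20 = f) (hof : o + f ≤ P.length) :
    Halts w locate σ 40 (fun σ' => σ'.reg 21 = X.key ((P.drop o).take f) ∧
      σ'.reg 22 = 4 * X.slot (X.key ((P.drop o).take f)) ∧ σ'.mem = σ.mem ∧
      ∀ i < 21, σ'.reg i = σ.reg i) := by
  refine Halts.straight locate_isStraight (by simp [locate, substringKey, hashStep, block, cost]) ?_
  obtain ⟨h1, h2⟩ := h.locate_reg hX ho hf hof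
  exact ⟨h1, h2, locate_isStraight.run_mem locate_readOnly,
    fun i hi => locate_isStraight.run_reg (locate_keeps hi)⟩

/-- One probe restores the invariant of the search. -/
theorem halts_searchProbe (h : Ready w X P σ) (hX : X.IsIndexOf D) {o l n : ℕ}
    (ho : σ.reg 15 = o) (hl : σ.reg 16 = l) (hol : o + l ≤ P.length) (hn : σ.reg 19 = 2 ^ n) :
    Halts w searchProbe σ 70 (fun σ' => (P.drop o).take l ∈ prefixes D →
      SearchInv D ((P.drop o).take l) (n + 1) (σ.reg 17) (σ.reg 18) →
      SearchInv D ((P.drop o).take l) n (σ'.reg 17) (σ'.reg 18)) := by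
  set q := (P.drop o).take l with hq_def
  -- If the query is no prefix of a string of `D`, or the invariant fails, only the time bound is
  -- claimed, and it follows because the probe has no loops.
  by_cases hq : q ∈ prefixes D ∧ SearchInv D q (n + 1) (σ.reg 17) (σ.reg 18)
  swap
  · refine Halts.mono (T₁ := 70) (Halts.of_loopFree ?_ ?_) le_rfl
      fun σ' _ h₁ h₂ => absurd ⟨h₁, h₂⟩ hq
    · simp [searchProbe, locate, narrow, substringKey, hashStep, block, IsLoopFree]
    · simp [searchProbe, locate, narrow, substringKey, hashStep, block, cost]
  obtain ⟨hq, hinv⟩ := hq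
  suffices Halts w searchProbe σ 70 (fun σ' => SearchInv D q n (σ'.reg 17) (σ'.reg 18)) from
    this.mono le_rfl fun _ h _ _ => h
  have hT := h.table_lt
  have hql : q.length = l := by simp [hq_def]; omega
  have h9 := h.hashes_lt
  obtain ⟨L, hL⟩ : ∃ L, σ.reg 17 = L := ⟨_, rfl⟩
  obtain ⟨B, hB⟩ : ∃ B, σ.reg 18 = B := ⟨_, rfl⟩
  rw [hL, hB] at hinv
  have hBl := hinv.upper_le
  refine Halts.ite (T₁ := 69) (fun hLB => ?_) (fun hLB => ?_) le_rfl
  swap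
  · refine Halts.straight trivial (by simp [cost]) ?_
    simp only [RamTest.Holds, hL, hB, not_lt] at hLB
    simpa only [run, hL, hB] using hinv.of_le hLB
  simp only [RamTest.Holds, hL, hB] at hLB
  have hfB : SearchInv.probe n B < B := SearchInv.probe_lt (by omega)
  have e1 : RamOp.sub.eval w B 1 = B - 1 := RamOp.eval_sub (by omega) (by omega)
  have e2 : RamOp.mod.eval w (B - 1) (2 ^ n) = (B - 1) % 2 ^ n := rfl
  have e3 : RamOp.sub.eval w (B - 1) ((B - 1) % 2 ^ n) = SearchInv.probe n B :=
    RamOp.eval_sub (by omega) (Nat.mod_le _ _)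
  obtain ⟨f, hf⟩ : ∃ f, SearchInv.probe n B = f := ⟨_, rfl⟩
  have hqf : q.take f = (P.drop o).take f := by
    rw [hq_def, List.take_take]; congr 1; omega
  refine Halts.seq (T₁ := 4) (T₂ := 65) (R := fun σ' => σ'.reg 20 = f ∧ σ'.mem = σ.mem ∧
    ∀ i < 20, σ'.reg i = σ.reg i) (Halts.straight ?_ ?_ ?_) ?_ le_rfl
  · simp [block, IsStraight]
  · simp [block, cost]
  · refine ⟨?_, rfl, fun i hi => ?_⟩
    · simp [block, run, h.one, hB, hn, e1, e2, e3, hf]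
    · simp [block, run, show i ≠ 20 by omega, show i ≠ 23 by omega, show i ≠ 24 by omega]
  rintro σ₁ ⟨f1, m1, k1⟩
  have h1 : Ready w X P σ₁ := h.congr m1 fun i hi => k1 i (by omega)
  refine Halts.ite (T₁ := 64) (fun hLf => ?_) (fun hLf => ?_) le_rfl
  swap
  · refine Halts.straight trivial (by simp [cost]) ?_
    simp only [RamTest.Holds, f1, k1 17 (by norm_num), hL, not_le] at hLf
    simpa only [run, k1 17 (by norm_num), k1 18 (by norm_num), hL, hB] using
      hinv.of_probe_lt (hf ▸ hLf)
  simp only [RamTest.Holds, f1, k1 17 (by norm_num), hL] at hLf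
  refine Halts.seq (T₂ := 24) (h1.halts_locate hX ((k1 15 (by norm_num)).trans ho) f1 (by omega)) ?_
    le_rfl
  rintro σ₂ ⟨g1, g2, m2, k2⟩
  rw [← hqf] at g1 g2
  have hqfp : q.take f ∈ prefixes D := mem_prefixes_of_prefix (q.take_prefix f) hq
  have hslot := hX.slot_lt (X.key (q.take f))
  have h2 : Ready w X P σ₂ := h1.congr m2 fun i hi => k2 i (by omega)
  have v16 : σ₂.reg 16 = l := by rw [k2 _ (by norm_num), k1 _ (by norm_num), hl]
  have v17 : σ₂.reg 17 = L := by rw [k2 _ (by norm_num), k1 _ (by norm_num), hL]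
  have v18 : σ₂.reg 18 = B := by rw [k2 _ (by norm_num), k1 _ (by norm_num), hB]
  have v20 : σ₂.reg 20 = f := by rw [k2 _ (by norm_num), f1]
  refine Halts.seq (T₁ := 1) (T₂ := 23)
    (R := fun σ' => σ' = σ₂.setReg 23 (X.fld (X.slot (X.key (q.take f))) 0))
    (Halts.straight trivial le_rfl ?_) ?_ le_rfl
  · simp only [run, g2]
    rw [← h2.table _ hslot 0 (by norm_num), add_zero]
  rintro σ₃ rfl
  refine Halts.ite (T₁ := 22) (fun hhit => ?_) (fun hmiss => ?_) le_rfl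
  -- Matching keys imply a stored prefix, since `q.take f` is a prefix of a string of `D` and false
  -- matches are excluded for those.
  · have hs : q.take f ∈ stored D := by
      by_contra hs
      simp only [RamTest.Holds, RamState.setReg_reg, g1] at hhit
      exact hX.miss _ hqfp hs hhit
    obtain ⟨-, hext, -, -⟩ := hX.hit _ hs
    refine Halts.seq (T₁ := 3) (T₂ := 19) (R := fun σ' => σ'.reg 23 = extentLength D (q.take f) ∧
      σ'.reg 5 = 1 ∧ ∀ i, 15 < i → i < 21 → σ'.reg i = σ₂.reg i)
      (Halts.straight ?_ ?_ ⟨?_, ?_, ?_⟩) ?_ le_rfl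
    · simp [block, IsStraight]
    · simp [block, cost]
    · have e4 : RamOp.add.eval w (4 * X.slot (X.key (q.take f))) 1 =
          4 * X.slot (X.key (q.take f)) + 1 := RamOp.eval_add (by omega)
      simp [block, run, g2, h2.one, e4, h2.table _ hslot 1 (by norm_num), hext]
    · simp [block, run, h2.one]
    · intro i hi hi'
      simp [block, run, show i ≠ 23 by omega]
    rintro σ₄ ⟨x1, x2, x3⟩
    refine Halts.ite (T₁ := 18) (fun hlt => ?_) (fun hge => ?_) le_rfl
    · simp only [RamTest.Holds, x1, x3 16 (by norm_num) (by norm_num), v16] at hlt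
      refine Halts.straight trivial (by simp [cost]) ?_
      have e5 : RamOp.add.eval w (extentLength D (q.take f)) 1 = extentLength D (q.take f) + 1 :=
        RamOp.eval_add (by omega)
      have := hinv.hit_short hq hLB (by rw [hf, hql]; exact hlt)
      rw [hf] at this
      simpa [run, x1, x2, e5, x3, v18] using this
    · simp only [RamTest.Holds, x1, x3 16 (by norm_num) (by norm_num), v16, not_lt] at hge
      refine Halts.straight (by simp [block, IsStraight]) (by simp [block, cost]) ?_
      have := hinv.hit_long hq hLB (by rw [hf]; exact hs) (by rw [hf, hql]; exact hge)
      rw [hf] at this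
      simpa [block, run, x3, v20] using this
  · have hs : q.take f ∉ stored D := by
      intro hs
      simp only [RamTest.Holds, RamState.setReg_reg, g1] at hmiss
      exact hmiss (hX.hit _ hs).1
    refine Halts.straight trivial (by simp [cost]) ?_
    have := hinv.miss hq hLB (by rw [hf]; exact hs) (by rw [hf]; exact hLf)
    rw [hf] at this
    simpa [run, v17, v20] using this

theorem searchProbe_readOnly : searchProbe.ReadOnly := by
  simp [searchProbe, narrow, locate, substringKey, hashStep, block, ReadOnly]

theorem searchProbe_keeps {i : ℕ} (hi : i < 17 ∨ i = 19) : searchProbe.Keeps i := by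
  simp [searchProbe, narrow, locate, substringKey, hashStep, block, Keeps]; omega

theorem halts_searchRound (h : Ready w X P σ) (hX : X.IsIndexOf D) {o l n : ℕ}
    (ho : σ.reg 15 = o) (hl : σ.reg 16 = l) (hol : o + l ≤ P.length) (hn : σ.reg 19 = 2 ^ n) :
    Halts w searchRound σ 80 (fun σ' => ((P.drop o).take l ∈ prefixes D →
      SearchInv D ((P.drop o).take l) (n + 1) (σ.reg 17) (σ.reg 18) →
      SearchInv D ((P.drop o).take l) n (σ'.reg 17) (σ'.reg 18)) ∧ σ'.reg 19 = 2 ^ n / 2 ∧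
      σ'.mem = σ.mem ∧ ∀ i < 17, σ'.reg i = σ.reg i) := by
  have hT := h.table_lt
  have hT2 := hX.two_le_T
  refine Halts.seq (T₂ := 10) ((h.halts_searchProbe hX ho hl hol hn).frame searchProbe_readOnly)
    ?_ le_rfl
  rintro σ₁ ⟨h1, h2, h3⟩
  refine Halts.straight (by simp [block, IsStraight]) (by simp [block, cost]) ⟨?_, ?_, ?_, ?_⟩
  · simpa [block, run] using h1
  · simp only [block, run, RamState.setReg_reg, h3 19 (searchProbe_keeps (.inr rfl)), hn,
      RamOp.eval]
    norm_num
    rw [Nat.mod_eq_of_lt (by omega)]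
  · simpa [block, run] using h2
  · intro i hi
    simp [block, run, show i ≠ 19 by omega, show i ≠ 23 by omega, h3 i (searchProbe_keeps (.inl hi))]

/-- The loop of the search. -/
theorem halts_search (h : Ready w X P σ) (hX : X.IsIndexOf D) {o l n : ℕ}
    (ho : σ.reg 15 = o) (hl : σ.reg 16 = l) (hol : o + l ≤ P.length)
    (hn : σ.reg 19 = 2 ^ n / 2)
    (hinv : (P.drop o).take l ∈ prefixes D →
      SearchInv D ((P.drop o).take l) n (σ.reg 17) (σ.reg 18)) :
    Halts w (.loop (.ne 19 12) searchRound) σ (n * 81 + 1) (fun σ' =>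
      ((P.drop o).take l ∈ prefixes D →
        SearchInv D ((P.drop o).take l) 0 (σ'.reg 17) (σ'.reg 18)) ∧
      σ'.mem = σ.mem ∧ ∀ i < 17, σ'.reg i = σ.reg i) := by
  -- With `n` rounds left the register holds `2 ^ n / 2`, which vanishes exactly at `n = 0` and so
  -- serves as the loop counter.
  refine Halts.mono (Halts.loop (T₁ := 80) (fun n σ' => σ'.reg 19 = 2 ^ n / 2 ∧
      ((P.drop o).take l ∈ prefixes D →
        SearchInv D ((P.drop o).take l) n (σ'.reg 17) (σ'.reg 18)) ∧
      σ'.mem = σ.mem ∧ ∀ i < 17, σ'.reg i = σ.reg i) ?_ ?_ n ⟨hn, hinv, rfl, fun _ _ => rfl⟩ le_rfl)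
      le_rfl fun σ' h => h.2
  · rintro n σ₁ ⟨h1, h2, h3, h4⟩
    have hR : Ready w X P σ₁ := h.congr h3 fun i hi => h4 i (by omega)
    rw [pow_succ, Nat.mul_div_cancel _ two_pos] at h1
    constructor
    · simp [RamTest.Holds, h1, hR.zero]
    · refine (hR.halts_searchRound hX ((h4 _ (by norm_num)).trans ho)
        ((h4 _ (by norm_num)).trans hl) hol h1).mono le_rfl ?_
      rintro σ₂ ⟨g1, g2, g3, g4⟩
      exact ⟨g2, fun hq => g1 hq (h2 hq), g3.trans h3, fun i hi => (g4 i hi).trans (h4 i hi)⟩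
  · rintro σ₁ ⟨h1, -, h3, h4⟩
    have hR : Ready w X P σ₁ := h.congr h3 fun i hi => h4 i (by omega)
    simp [RamTest.Holds, h1, hR.zero]

end Ready

namespace Ready

variable {w : ℕ} {X : PrefixIndex} {D : Finset (List ℕ)} {P : List ℕ} {σ σ' : RamState}

/-- There are `K + 1` rounds of at most `81` steps, with the powers `2 ^ K` down to `2 ^ 0`;
everything else takes constant time. -/
theorem halts_answerQuery (h : Ready w X P σ) (hX : X.IsIndexOf D) {o l K a c : ℕ}
    (hK : σ.reg 11 = 2 ^ K) (hPK : P.length < 2 ^ K) (ha : σ.reg 13 = a) (hao : σ.mem a = o)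
    (hal : σ.mem (a + 1) = l) (hol : o + l ≤ P.length) (haw : a + 2 < 2 ^ w)
    (hc : σ.reg 14 = c) (hcw : c + 2 < 2 ^ w) :
    Halts w answerQuery σ (81 * K + 152) (fun σ' => σ'.reg 13 = a + 2 ∧ σ'.reg 14 = c + 2 ∧
      (∀ i < 13, σ'.reg i = σ.reg i) ∧ (∀ b, b ≠ c → b ≠ c + 1 → σ'.mem b = σ.mem b) ∧
      IsWeakPrefixAnswer D ((P.drop o).take l) (σ'.mem c) (σ'.mem (c + 1))) := by
  set q := (P.drop o).take l with hq_def
  have hql : q.length = l := by simp [hq_def]; omega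
  have h9 := h.hashes_lt
  have hT := h.table_lt
  refine Halts.seq (T₁ := 8) (T₂ := 81 * K + 144) (R := fun σ' => σ'.reg 13 = a + 2 ∧
    σ'.reg 15 = o ∧ σ'.reg 16 = l ∧ σ'.reg 17 = 0 ∧ σ'.reg 18 = l + 1 ∧ σ'.reg 19 = 2 ^ K ∧
    σ'.reg 14 = c ∧ σ'.mem = σ.mem ∧ ∀ i < 13, σ'.reg i = σ.reg i)
    (Halts.straight ?_ ?_ ?_) ?_ (by omega)
  · simp [block, IsStraight]
  · simp [block, cost]
  · have e1 : RamOp.add.eval w a 1 = a + 1 := RamOp.eval_add (by omega)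
    have e2 : RamOp.add.eval w (a + 1) 1 = a + 2 := RamOp.eval_add (by omega)
    have e3 : RamOp.add.eval w l 1 = l + 1 := RamOp.eval_add (by omega)
    have hi : ∀ i < 13, i ≠ 13 ∧ i ≠ 15 ∧ i ≠ 16 ∧ i ≠ 17 ∧ i ≠ 18 ∧ i ≠ 19 := by omega
    simp +contextual [block, run, h.one, ha, hao, hal, e1, e2, e3, hK, hc, hi]
  rintro σ₁ ⟨a1, a2, a3, a4, a5, a6, a7, m1, k1⟩
  have h1 : Ready w X P σ₁ := h.congr m1 k1
  refine Halts.seq (T₁ := (K + 1) * 81 + 1) (T₂ := 62)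
    (h1.halts_search hX (n := K + 1) a2 a3 hol ?_ ?_) ?_ (by omega)
  · rw [a6, pow_succ, Nat.mul_div_cancel _ two_pos]
  · intro hq
    have hi : SearchInv D q (K + 1) 0 (q.length + 1) := by
      refine SearchInv.init hq ?_
      rw [pow_succ, Nat.mul_div_cancel _ two_pos]
      omega
    rw [a4, a5]
    rwa [hql] at hi
  rintro σ₂ ⟨s2, m2, k2⟩
  have h2 : Ready w X P σ₂ := h1.congr m2 fun i hi => k2 i (by omega)
  refine Halts.seq (T₁ := 1) (T₂ := 61) (R := fun σ' => σ' = σ₂.setReg 20 (σ₂.reg 17))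
    (Halts.straight trivial le_rfl rfl) ?_ le_rfl
  rintro _ rfl
  set σ₃ := σ₂.setReg 20 (σ₂.reg 17) with hσ₃
  have k3 : ∀ i < 17, σ₃.reg i = σ₂.reg i := fun i hi => by
    simp [hσ₃, show i ≠ 20 by omega]
  have h3 : Ready w X P σ₃ := h2.congr rfl fun i hi => k3 i (by omega)
  -- If `q` is no prefix of a string of `D`, the value of `L` is unconstrained; the lookup is
  -- straight-line code and still halts in time.
  refine Halts.seq (T₁ := 40) (T₂ := 21) (R := fun σ' => (q ∈ prefixes D →
      σ'.reg 22 = 4 * X.slot (X.key (q.take (σ₂.reg 17)))) ∧ σ'.mem = σ₃.mem ∧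
      ∀ i < 21, σ'.reg i = σ₃.reg i) ?_ ?_ le_rfl
  · refine Halts.straight locate_isStraight
      (by simp [locate, substringKey, hashStep, block, cost]) ⟨fun hq => ?_,
        locate_isStraight.run_mem locate_readOnly,
        fun i hi => locate_isStraight.run_reg (locate_keeps hi)⟩
    have hL : σ₂.reg 17 ≤ q.length := (s2 hq).le_length
    have := (h3.locate_reg hX (o := o) (f := σ₂.reg 17) ?_ (by simp [hσ₃]) (by omega)).2
    · rw [this, hq_def, List.take_take, min_eq_left (by omega)]
    · rw [k3 _ (by norm_num), k2 _ (by norm_num), a2]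
  rintro σ₄ ⟨v4, m4, k4⟩
  have h4 : Ready w X P σ₄ := h3.congr m4 fun i hi => k4 i (by omega)
  have b13 : σ₄.reg 13 = a + 2 := by
    rw [k4 _ (by norm_num), k3 _ (by norm_num), k2 _ (by norm_num), a1]
  have b14 : σ₄.reg 14 = c := by
    rw [k4 _ (by norm_num), k3 _ (by norm_num), k2 _ (by norm_num), a7]
  have e1 : RamOp.add.eval w c 1 = c + 1 := RamOp.eval_add (by omega)
  have e2 : RamOp.add.eval w (c + 1) 1 = c + 2 := RamOp.eval_add (by omega)
  have hmem : σ₄.mem = σ.mem := m4.trans (m2.trans m1)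
  refine Halts.straight (by simp [block, IsStraight]) (by simp [block, cost])
    ⟨?_, ?_, ?_, ?_, ?_⟩
  · simp [block, run, b13]
  · simp [block, run, b14, h4.one, e1, e2]
  · intro i hi
    simp [block, run, show i ≠ 14 by omega, show i ≠ 22 by omega, show i ≠ 23 by omega,
      show i ≠ 24 by omega, k4 i (by omega), k3 i (by omega), k2 i (by omega), k1 i hi]
  · intro b hb hb'
    simp [block, run, b14, h4.one, e1, hb, hb', hmem]
  · by_cases hq : q ∈ prefixes D
    swap
    · exact fun h => absurd (mem_prefixes.2 h) hq
    have hinv := s2 hq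
    set u := q.take (σ₂.reg 17)
    have v := v4 hq
    have hslot := hX.slot_lt (X.key u)
    have f1 : RamOp.add.eval w (4 * X.slot (X.key u)) 1 = 4 * X.slot (X.key u) + 1 :=
      RamOp.eval_add (by omega)
    have f2 : RamOp.add.eval w (4 * X.slot (X.key u) + 1) 1 = 4 * X.slot (X.key u) + 2 :=
      RamOp.eval_add (by omega)
    have f3 : RamOp.add.eval w (4 * X.slot (X.key u) + 2) 1 = 4 * X.slot (X.key u) + 3 :=
      RamOp.eval_add (by omega)
    obtain ⟨-, -, hlo, hhi⟩ := hX.hit u hinv.mem_stored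
    have g2 := h4.table _ hslot 2 (by norm_num)
    have g3 := h4.table _ hslot 3 (by norm_num)
    rw [hlo] at g2
    rw [hhi] at g3
    simp [block, run, b14, h4.one, e1, v, f1, f2, f3, g2, g3]
    exact isWeakPrefixAnswer_rank hinv.withPrefix_eq

end Ready

/-! ### The tables -/

section tables

variable {w : ℕ} {X : PrefixIndex} {D : Finset (List ℕ)} {P : List ℕ} {σ : RamState}

/-- The first `j + 1` entries of the tables have been computed. -/
structure TableInv (X : PrefixIndex) (P : List ℕ) (σ₀ : RamState) (j : ℕ) (σ : RamState) :
    Prop where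
  index : σ.reg 13 = j
  hash : σ.reg 21 = X.key (P.take j)
  power : σ.reg 22 = X.b ^ j % X.p
  reg_eq : ∀ i < 13, σ.reg i = σ₀.reg i
  mem_eq : ∀ a < σ₀.reg 9, σ.mem a = σ₀.mem a
  hashes : ∀ i ≤ j, σ.mem (σ₀.reg 9 + i) = X.key (P.take i)
  powers : ∀ i ≤ j, σ.mem (σ₀.reg 10 + i) = X.b ^ i % X.p

theorem TableInv.halts_tableStep {σ₀ : RamState} {j : ℕ} (h : TableInv X P σ₀ j σ)
    (hX : X.IsIndexOf D) (hj : j < P.length) (h5 : σ₀.reg 5 = 1) (h7 : σ₀.reg 7 = X.p)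
    (h8 : σ₀.reg 8 = X.b) (hpat : ∀ i c, P[i]? = some c → σ₀.mem (σ₀.reg 0 + i) = c)
    (hP : ∀ c ∈ P, c ≤ X.p) (hpp : X.p * X.p < 2 ^ w) (h0F : σ₀.reg 0 + P.length ≤ σ₀.reg 9)
    (hFW : σ₀.reg 9 + P.length < σ₀.reg 10) (hW : σ₀.reg 10 + P.length < 2 ^ w) :
    Halts w tableStep σ 13 (TableInv X P σ₀ (j + 1)) := by
  have hp1 := hX.one_lt_p
  have hb : X.b ≤ X.p := hX.fld_b ▸ hX.fld_le 1 1
  obtain ⟨i1, i2, i3, i4, i5, i6, i7⟩ := h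
  have hk : X.key (P.take j) < X.p := fingerprint.lt (by omega) _
  have hpw : X.b ^ j % X.p < X.p := Nat.mod_lt _ (by omega)
  have hc : P[j]? = some P[j] := List.getElem?_eq_getElem hj
  have hcp : P[j] ≤ X.p := hP _ (List.getElem_mem hj)
  -- The fingerprint is at most `p - 1`, and base and letter are at most `p`, so the Horner step
  -- stays within `p * p`.
  have hmul : X.key (P.take j) * X.b + P[j] ≤ X.p * X.p := by nlinarith
  have hmul2 : X.b ^ j % X.p * X.b ≤ X.p * X.p := Nat.mul_le_mul hpw.le hb
  have m0 : σ.mem (σ₀.reg 0 + j) = P[j] := by rw [i5 _ (by omega)]; exact hpat j _ hc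
  have r0 := i4 0 (by norm_num)
  have r5 := (i4 5 (by norm_num)).trans h5
  have r7 := (i4 7 (by norm_num)).trans h7
  have r8 := (i4 8 (by norm_num)).trans h8
  have r9 := i4 9 (by norm_num)
  have r10 := i4 10 (by norm_num)
  have e1 : RamOp.add.eval w (σ₀.reg 0) j = σ₀.reg 0 + j := RamOp.eval_add (by omega)
  have e2 : RamOp.mul.eval w (X.key (P.take j)) X.b = X.key (P.take j) * X.b :=
    RamOp.eval_mul (by omega)
  have e3 : RamOp.add.eval w (X.key (P.take j) * X.b) P[j] = X.key (P.take j) * X.b + P[j] :=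
    RamOp.eval_add (by omega)
  have e4 : RamOp.mod.eval w (X.key (P.take j) * X.b + P[j]) X.p = X.key (P.take (j + 1)) := by
    rw [List.take_succ_eq_append_getElem hj]
    exact (fingerprint.concat _ _).symm
  have e5 : RamOp.mul.eval w (X.b ^ j % X.p) X.b = X.b ^ j % X.p * X.b :=
    RamOp.eval_mul (by omega)
  have e6 : RamOp.mod.eval w (X.b ^ j % X.p * X.b) X.p = X.b ^ (j + 1) % X.p := by
    show X.b ^ j % X.p * X.b % X.p = _
    rw [Nat.mod_mul_mod, pow_succ]
  have e7 : RamOp.add.eval w j 1 = j + 1 := RamOp.eval_add (by omega)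
  have e8 : RamOp.add.eval w (σ₀.reg 9) (j + 1) = σ₀.reg 9 + (j + 1) :=
    RamOp.eval_add (by omega)
  have e9 : RamOp.add.eval w (σ₀.reg 10) (j + 1) = σ₀.reg 10 + (j + 1) :=
    RamOp.eval_add (by omega)
  have hreg : (tableStep.run w σ).reg 13 = j + 1 ∧
      (tableStep.run w σ).reg 21 = X.key (P.take (j + 1)) ∧
      (tableStep.run w σ).reg 22 = X.b ^ (j + 1) % X.p := by
    simp [tableStep, block, run, i1, i2, i3, r0, r5, r7, r8, e1, m0, e2, e3, e4, e5, e6, e7]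
  have hmem : ∀ a, (tableStep.run w σ).mem a = if a = σ₀.reg 10 + (j + 1) then
      X.b ^ (j + 1) % X.p else if a = σ₀.reg 9 + (j + 1) then X.key (P.take (j + 1)) else
      σ.mem a := by
    intro a
    simp [tableStep, block, run, i1, i2, i3, r0, r5, r7, r8, r9, r10, e1, m0, e2, e3, e4, e5, e6,
      e7, e8, e9]
  refine Halts.straight (by simp [tableStep, block, IsStraight]) (by simp [tableStep, block, cost])
    ⟨hreg.1, hreg.2.1, hreg.2.2, ?_, ?_, ?_, ?_⟩
  · intro i hi
    rw [← i4 i hi]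
    refine IsStraight.run_reg (by simp [tableStep, block, IsStraight]) ?_
    simp [tableStep, block, Keeps]; omega
  · intro a ha
    rw [hmem, if_neg (by omega), if_neg (by omega), i5 a ha]
  · intro i hi
    rw [hmem, if_neg (by omega)]
    split_ifs with hij
    · rw [show i = j + 1 by omega]
    · exact i6 i (by omega)
  · intro i hi
    rw [hmem]
    split_ifs with hij
    · rw [show i = j + 1 by omega]
    · omega
    · exact i7 i (by omega)

theorem halts_tables {σ₀ : RamState} (h : TableInv X P σ₀ 0 σ₀) (hX : X.IsIndexOf D)
    (h1 : σ₀.reg 1 = P.length) (h5 : σ₀.reg 5 = 1) (h7 : σ₀.reg 7 = X.p)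
    (h8 : σ₀.reg 8 = X.b) (hpat : ∀ i c, P[i]? = some c → σ₀.mem (σ₀.reg 0 + i) = c)
    (hP : ∀ c ∈ P, c ≤ X.p) (hpp : X.p * X.p < 2 ^ w) (h0F : σ₀.reg 0 + P.length ≤ σ₀.reg 9)
    (hFW : σ₀.reg 9 + P.length < σ₀.reg 10) (hW : σ₀.reg 10 + P.length < 2 ^ w) :
    Halts w (.loop (.lt 13 1) tableStep) σ₀ (P.length * 14 + 1) (TableInv X P σ₀ P.length) := by
  refine Halts.mono (Halts.loop (T₁ := 13)
    (fun n σ => n ≤ P.length ∧ TableInv X P σ₀ (P.length - n) σ) ?_ ?_ P.length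
    ⟨le_rfl, by rwa [Nat.sub_self]⟩ le_rfl) le_rfl fun σ' h => h.2
  · rintro n σ ⟨hn, hI⟩
    refine ⟨?_, ?_⟩
    · simp only [RamTest.Holds, hI.index, hI.reg_eq 1 (by norm_num), h1]; omega
    · refine (hI.halts_tableStep hX (by omega) h5 h7 h8 hpat hP hpp h0F hFW hW).mono le_rfl
        fun σ' h' => ⟨by omega, ?_⟩
      rwa [show P.length - n = P.length - (n + 1) + 1 by omega]
  · rintro σ ⟨-, hI⟩
    simp only [RamTest.Holds, hI.index, hI.reg_eq 1 (by norm_num), h1]; omega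

end tables

theorem halts_doubling {w m : ℕ} {σ : RamState} (h1 : σ.reg 1 = m) (h11 : σ.reg 11 = 1)
    (hw : m + m < 2 ^ w) :
    Halts w (.loop (.le 11 1) (.op .add 11 11 11)) σ (m.size * 2 + 1) (fun σ' =>
      σ'.reg 11 = 2 ^ m.size ∧ σ'.mem = σ.mem ∧ ∀ i, i ≠ 11 → σ'.reg i = σ.reg i) := by
  refine Halts.mono (Halts.loop (T₁ := 1) (fun n σ' => n ≤ m.size ∧
      σ'.reg 11 = 2 ^ (m.size - n) ∧ σ'.mem = σ.mem ∧ ∀ i, i ≠ 11 → σ'.reg i = σ.reg i) ?_ ?_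
      m.size ⟨le_rfl, by simpa using h11, rfl, fun _ _ => rfl⟩ le_rfl) le_rfl fun σ' h => h.2
  · rintro n σ₁ ⟨hn, h2, h3, h4⟩
    -- Before each doubling the value is at most `m`, so the result is at most `m + m` and does not
    -- overflow.
    have hle : 2 ^ (m.size - (n + 1)) ≤ m := Nat.lt_size.1 (by omega)
    refine ⟨?_, Halts.straight trivial le_rfl ⟨by omega, ?_, h3, fun i hi => ?_⟩⟩
    · simp only [RamTest.Holds, h2, h4 1 (by norm_num), h1, hle]
    · simp only [run, RamState.setReg_reg, if_pos, h2]
      rw [RamOp.eval_add (by omega), show m.size - n = m.size - (n + 1) + 1 by omega, pow_succ]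
      ring
    · simp [run, hi, h4 i hi]
  · rintro σ₁ ⟨-, h2, -, h4⟩
    simp only [RamTest.Holds, h2, h4 1 (by norm_num), h1, Nat.sub_zero, not_le]
    exact Nat.lt_size_self m

/-! ## Correctness of the query program -/

theorem getElem?_flatMap_pair (Q : List (ℕ × ℕ)) (i : ℕ) :
    (Q.flatMap (fun q => [q.1, q.2]))[2 * i]? = Q[i]?.map Prod.fst ∧
      (Q.flatMap (fun q => [q.1, q.2]))[2 * i + 1]? = Q[i]?.map Prod.snd := by
  induction Q generalizing i with
  | nil => simp
  | cons q Q ih =>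
    cases i with
    | zero => simp
    | succ i =>
      have h1 : 2 * (i + 1) = 2 * i + 1 + 1 := by ring
      simpa [h1] using ih i

theorem length_batchInput (data P : List ℕ) (Q : List (ℕ × ℕ)) :
    (batchInput data P Q).length = data.length + P.length + 2 * Q.length := by
  have : (Q.flatMap (fun q => [q.1, q.2])).length = 2 * Q.length := by
    induction Q with
    | nil => rfl
    | cons q Q ih => simp only [List.flatMap_cons, List.length_append, ih, List.length_cons,
        List.length_nil]; ring
  simp [batchInput, this, add_assoc]

namespace IsBatchStart

variable {w : ℕ} {data P : List ℕ} {Q : List (ℕ × ℕ)} {σ : RamState}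

theorem mem_data (h : IsBatchStart w data P Q σ) {i v : ℕ} (hv : data[i]? = some v) :
    σ.mem i = v := by
  have hi := (List.getElem?_eq_some_iff.1 hv).1
  refine h.mem_eq i v ?_
  rw [batchInput, List.append_assoc, List.getElem?_append_left hi, hv]

theorem mem_pattern (h : IsBatchStart w data P Q σ) {i v : ℕ} (hv : P[i]? = some v) :
    σ.mem (data.length + i) = v := by
  have hi := (List.getElem?_eq_some_iff.1 hv).1
  refine h.mem_eq _ v ?_
  rw [batchInput, List.append_assoc, List.getElem?_append_right (by omega),
    Nat.add_sub_cancel_left, List.getElem?_append_left hi, hv]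

theorem mem_query (h : IsBatchStart w data P Q σ) {i : ℕ} {q : ℕ × ℕ} (hq : Q[i]? = some q) :
    σ.mem (data.length + P.length + 2 * i) = q.1 ∧
      σ.mem (data.length + P.length + 2 * i + 1) = q.2 := by
  constructor <;> refine h.mem_eq _ _ ?_ <;>
    rw [batchInput, List.getElem?_append_right (by simp only [List.length_append]; omega),
      List.length_append]
  · rw [Nat.add_sub_cancel_left, (getElem?_flatMap_pair Q i).1, hq]; rfl
  · rw [add_assoc, Nat.add_sub_cancel_left, (getElem?_flatMap_pair Q i).2, hq]; rfl

end IsBatchStart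

/-- The initialization of the query program. -/
theorem halts_setup {w : ℕ} {X : PrefixIndex} {D : Finset (List ℕ)} {P : List ℕ}
    {Q : List (ℕ × ℕ)} {σ : RamState} (hX : X.IsIndexOf D)
    (hW : 4 * X.T + 3 * P.length + 4 * Q.length + 2 < 2 ^ w)
    (hσ : IsBatchStart w X.words P Q σ) :
    Halts w (block [const 5 1, const 6 4, const 12 0, load 7 6, op .add 23 6 5, load 8 23,
      op .add 9 3 3, op .add 9 9 4, op .add 10 9 1, op .add 10 10 5,
      const 13 0, const 21 0, const 22 1, store 9 21, store 10 22]) σ 16 (fun σ' =>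
      TableInv X P σ' 0 σ' ∧ σ'.reg 5 = 1 ∧ σ'.reg 6 = 4 ∧ σ'.reg 7 = X.p ∧ σ'.reg 8 = X.b ∧
      σ'.reg 9 = 4 * X.T + P.length + 4 * Q.length ∧
      σ'.reg 10 = 4 * X.T + 2 * P.length + 4 * Q.length + 1 ∧ σ'.reg 12 = 0 ∧
      (∀ i < 5, σ'.reg i = σ.reg i) ∧
      ∀ a < 4 * X.T + P.length + 4 * Q.length, σ'.mem a = σ.mem a) := by
  have hp1 := hX.one_lt_p
  have hT2 := hX.two_le_T
  have hlen := length_batchInput X.words P Q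
  have r1 := hσ.reg_patternLength
  have r3 := hσ.reg_queryCount
  have r4 := hσ.reg_answers
  rw [hlen, X.length_words] at r4
  -- Addresses `4` and `5` are the first two words of record `1`.
  have m4 : σ.mem 4 = X.p := by
    rw [← hX.fld_p]
    exact hσ.mem_data (X.getElem?_words (R := 1) (r := 0) (by omega) (by norm_num))
  have m5 : σ.mem 5 = X.b := by
    rw [← hX.fld_b]
    exact hσ.mem_data (X.getElem?_words (R := 1) (r := 1) (by omega) (by norm_num))
  have c1 : 1 % 2 ^ w = 1 := Nat.mod_eq_of_lt (by omega)
  have c4 : 4 % 2 ^ w = 4 := Nat.mod_eq_of_lt (by omega)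
  have e1 : RamOp.add.eval w 4 1 = 5 := RamOp.eval_add (by omega)
  have e2 : RamOp.add.eval w Q.length Q.length = 2 * Q.length := by
    rw [RamOp.eval_add (by omega)]; ring
  -- The tables start behind the `2 * Q.length` cells reserved for the answers.
  have e3 : RamOp.add.eval w (2 * Q.length) (4 * X.T + P.length + 2 * Q.length) =
      4 * X.T + P.length + 4 * Q.length := by
    rw [RamOp.eval_add (by omega)]; ring
  have e4 : RamOp.add.eval w (4 * X.T + P.length + 4 * Q.length) P.length =
      4 * X.T + 2 * P.length + 4 * Q.length := by
    rw [RamOp.eval_add (by omega)]; ring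
  have e5 : RamOp.add.eval w (4 * X.T + 2 * P.length + 4 * Q.length) 1 =
      4 * X.T + 2 * P.length + 4 * Q.length + 1 := RamOp.eval_add (by omega)
  refine Halts.straight (by simp [block, IsStraight]) (by simp [block, cost]) ?_
  set F := 4 * X.T + P.length + 4 * Q.length with hF
  set W := 4 * X.T + 2 * P.length + 4 * Q.length + 1 with hWdef
  set p := block [const 5 1, const 6 4, const 12 0, load 7 6, op .add 23 6 5, load 8 23,
      op .add 9 3 3, op .add 9 9 4, op .add 10 9 1, op .add 10 10 5,
      const 13 0, const 21 0, const 22 1, store 9 21, store 10 22] with hp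
  have hst : p.IsStraight := by simp [hp, block, IsStraight]
  have hmem : ∀ a, (p.run w σ).mem a = if a = W then 1 else if a = F then 0 else σ.mem a := by
    intro a
    simp [hp, block, run, c1, c4, e1, e2, r1, r3, r4, e3, e4, e5, m4, m5]
  have g9 : (p.run w σ).reg 9 = F := by
    simp [hp, block, run, c1, c4, e1, e2, r1, r3, r4, e3, e4, e5, m4, m5]
  have g10 : (p.run w σ).reg 10 = W := by
    simp [hp, block, run, c1, c4, e1, e2, r1, r3, r4, e3, e4, e5, m4, m5]
  refine ⟨⟨?_, ?_, ?_, fun _ _ => rfl, fun _ _ => rfl, ?_, ?_⟩, ?_, ?_, ?_, ?_, g9, g10, ?_, ?_, ?_⟩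
  · simp [hp, block, run]
  · simp [hp, block, run]; rfl
  · simp [hp, block, run, c1]; rw [Nat.mod_eq_of_lt hp1]
  · intro i hi
    obtain rfl : i = 0 := by omega
    rw [g9, hmem, if_neg (by omega), if_pos (by omega)]; rfl
  · intro i hi
    obtain rfl : i = 0 := by omega
    rw [g10, hmem, if_pos (by omega), pow_zero, Nat.mod_eq_of_lt hp1]
  · simp [hp, block, run, c1]
  · simp [hp, block, run, c4]
  · simp [hp, block, run, c4, m4]
  · simp [hp, block, run, c1, c4, e1, m5]
  · simp [hp, block, run]
  · intro i hi
    refine hst.run_reg ?_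
    simp [hp, block, Keeps]; omega
  · intro a ha
    rw [hmem, if_neg (by omega), if_neg (by omega)]

/-- The loop over the queries. -/
theorem halts_queries {w K : ℕ} {X : PrefixIndex} {D : Finset (List ℕ)} {P : List ℕ}
    {Q : List (ℕ × ℕ)} {σ σ₄ : RamState} (hX : X.IsIndexOf D)
    (hQ : ∀ q ∈ Q, q.1 + q.2 ≤ P.length) (hW : 4 * X.T + 3 * P.length + 4 * Q.length + 2 < 2 ^ w)
    (hσ : IsBatchStart w X.words P Q σ) (hK : P.length < 2 ^ K) {A : ℕ}
    (hA : A = 4 * X.T + P.length + 2 * Q.length)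
    (hready : Ready w X P σ₄) (f4 : σ₄.reg 4 = A) (f9 : σ₄.reg 9 = A + 2 * Q.length)
    (f10 : σ₄.reg 10 = A + 2 * Q.length + P.length + 1) (f11 : σ₄.reg 11 = 2 ^ K)
    (f13 : σ₄.reg 13 = 4 * X.T + P.length) (f14 : σ₄.reg 14 = A)
    (fin : ∀ a < A, σ₄.mem a = σ.mem a) :
    Halts w (.loop (.lt 13 4) answerQuery) σ₄ (Q.length * (81 * K + 153) + 1)
      (IsBatchEnd D X.words P Q) := by
  have hlen := length_batchInput X.words P Q
  rw [X.length_words, ← hA] at hlen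
  -- Answers are written only to `[A, A + 2 * Q.length)`, between the input and the tables, so
  -- everything the search reads survives.
  have hready : ∀ σ' : RamState, (∀ i < 13, σ'.reg i = σ₄.reg i) →
      (∀ a < A, σ'.mem a = σ.mem a) →
      (∀ a ≥ A + 2 * Q.length, σ'.mem a = σ₄.mem a) → Ready w X P σ' := by
    intro σ' hr h1 h2
    obtain ⟨b1, b2, b3, b4, b5, b6, b7, b8, b9, b10, b11⟩ := hready
    refine ⟨b1, b2, ?_, ?_, ?_, ?_, ?_, ?_, ?_, ?_, ?_⟩
    · rw [hr 5 (by norm_num), b3]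
    · rw [hr 6 (by norm_num), b4]
    · rw [hr 7 (by norm_num), b5]
    · rw [hr 12 (by norm_num), b6]
    · intro R hR r hr
      rw [h1 _ (by omega), ← fin _ (by omega), b7 R hR r hr]
    · rwa [hr 9 (by norm_num)]
    · intro j hj
      rw [hr 9 (by norm_num), h2 _ (by omega), b9 j hj]
    · rwa [hr 10 (by norm_num)]
    · intro j hj
      rw [hr 10 (by norm_num), h2 _ (by omega), b11 j hj]
  refine Halts.mono (Halts.loop (T₁ := 81 * K + 152) (fun n σ' => n ≤ Q.length ∧
    σ'.reg 13 = 4 * X.T + P.length + 2 * (Q.length - n) ∧ σ'.reg 14 = A + 2 * (Q.length - n) ∧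
    (∀ i < 13, σ'.reg i = σ₄.reg i) ∧ (∀ a < A, σ'.mem a = σ.mem a) ∧
    (∀ a ≥ A + 2 * Q.length, σ'.mem a = σ₄.mem a) ∧
    ∀ i < Q.length - n, ∀ q, Q[i]? = some q → IsWeakPrefixAnswer D (substringAt P q)
      (σ'.mem (A + 2 * i)) (σ'.mem (A + 2 * i + 1))) ?_ ?_ Q.length ?_ le_rfl) ?_ ?_
  · rintro n σ₅ ⟨hn, g13, g14, gr, gin, gout, gans⟩
    have hR := hready σ₅ gr gin gout
    set i := Q.length - (n + 1) with hi
    have hiQ : i < Q.length := by omega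
    have hq : Q[i]? = some Q[i] := List.getElem?_eq_getElem hiQ
    have hmq := hσ.mem_query hq
    rw [X.length_words] at hmq
    refine ⟨?_, ?_⟩
    · simp only [RamTest.Holds, g13, gr 4 (by norm_num), f4]; omega
    refine (hR.halts_answerQuery hX (K := K) (o := Q[i].1) (l := Q[i].2) ?_
      hK g13 ?_ ?_ (hQ _ (List.getElem_mem hiQ)) (by omega) g14
      (by omega)).mono le_rfl ?_
    · rw [gr 11 (by norm_num), f11]
    · rw [gin _ (by omega), hmq.1]
    · rw [gin _ (by omega), hmq.2]
    rintro σ₆ ⟨k13, k14, kr, km, kans⟩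
    refine ⟨by omega, by omega, by omega, fun i hi => (kr i hi).trans (gr i hi), ?_, ?_, ?_⟩
    · intro a ha
      rw [km a (by omega) (by omega), gin a ha]
    · intro a ha
      rw [km a (by omega) (by omega), gout a ha]
    · intro j hj q hjq
      rcases Nat.lt_or_ge j i with hlt | hge
      · rw [km _ (by omega) (by omega), km _ (by omega) (by omega)]
        exact gans j hlt q hjq
      · obtain rfl : j = i := by omega
        rw [hq] at hjq
        obtain rfl := Option.some.inj hjq
        exact kans
  · rintro σ₅ ⟨-, g13, -, gr, -⟩
    simp only [RamTest.Holds, g13, gr 4 (by norm_num), f4]; omega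
  · exact ⟨le_rfl, by omega, by omega, fun _ _ => rfl, fin, fun _ _ => rfl, fun i hi => by omega⟩
  · have : Q.length * (1 + (81 * K + 152)) = Q.length * (81 * K + 153) := by ring
    omega
  · rintro σ₅ ⟨-, -, -, -, gin, -, gans⟩
    refine ⟨?_, ?_⟩
    · intro i v hv
      have hi := (List.getElem?_eq_some_iff.1 hv).1
      rw [X.length_words] at hi
      rw [gin i (by omega)]
      exact hσ.mem_data hv
    · intro i q hq
      have hi := (List.getElem?_eq_some_iff.1 hq).1
      rw [hlen]
      exact gans i (by omega) q hq

theorem halts_query {w : ℕ} {X : PrefixIndex} {D : Finset (List ℕ)} {P : List ℕ}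
    {Q : List (ℕ × ℕ)} {σ : RamState} (hX : X.IsIndexOf D) (hpp : X.p * X.p < 2 ^ w)
    (hP : ∀ c ∈ P, c ≤ X.p) (hQ : ∀ q ∈ Q, q.1 + q.2 ≤ P.length)
    (hW : 4 * X.T + 3 * P.length + 4 * Q.length + 2 < 2 ^ w)
    (hσ : IsBatchStart w X.words P Q σ) :
    Halts w query σ (14 * P.length + 2 * P.length.size + 23 +
      Q.length * (81 * P.length.size + 153)) (IsBatchEnd D X.words P Q) := by
  set K := P.length.size with hK
  have hlen := length_batchInput X.words P Q
  rw [X.length_words] at hlen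
  have r0 := hσ.reg_pattern
  have r1 := hσ.reg_patternLength
  have r2 := hσ.reg_queries
  have r4 := hσ.reg_answers
  rw [X.length_words] at r0 r2
  rw [hlen] at r4
  refine Halts.seq (T₂ := 14 * P.length + 2 * K + 7 + Q.length * (81 * K + 153))
    (halts_setup hX hW hσ) ?_ (by omega)
  rintro σ₁ ⟨hI, a5, a6, a7, a8, a9, a10, a12, ak, am⟩
  refine Halts.seq (T₂ := 2 * K + 6 + Q.length * (81 * K + 153))
    (halts_tables hI hX ((ak 1 (by norm_num)).trans r1) a5 a7 a8 ?_ hP hpp ?_ ?_ ?_) ?_ (by omega)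
  · intro i c hc
    have hi := (List.getElem?_eq_some_iff.1 hc).1
    have := hσ.mem_pattern hc
    rw [X.length_words] at this
    rw [ak 0 (by norm_num), r0, am _ (by omega), this]
  · rw [ak 0 (by norm_num), r0, a9]; omega
  · rw [a9, a10]; omega
  · rw [a10]; omega
  rintro σ₂ hI₂
  have bk := hI₂.reg_eq
  have bm := hI₂.mem_eq
  refine Halts.seq (T₁ := 1) (T₂ := 2 * K + 5 + Q.length * (81 * K + 153))
    (R := fun σ' => σ' = σ₂.setReg 11 (σ₂.reg 5)) (Halts.straight trivial le_rfl rfl) ?_ (by omega)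
  rintro _ rfl
  refine Halts.seq (T₂ := 4 + Q.length * (81 * K + 153))
    (halts_doubling (m := P.length) ?_ ?_ (by omega)) ?_ (by omega)
  · simp [bk, ak, r1]
  · simp [bk, a5]
  rintro σ₃ ⟨d11, dm, dk⟩
  refine Halts.seq (T₁ := 3) (T₂ := 1 + Q.length * (81 * K + 153)) (R := fun σ' =>
    σ'.reg 13 = 4 * X.T + P.length ∧ σ'.reg 14 = 4 * X.T + P.length + 2 * Q.length ∧
    σ'.reg 11 = 2 ^ K ∧ σ'.mem = σ₂.mem ∧ ∀ i < 13, i ≠ 11 → σ'.reg i = σ₁.reg i)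
    (Halts.straight ?_ ?_ ?_) ?_ (by omega)
  · simp [block, IsStraight]
  · simp [block, cost]
  · have v2 : σ₃.reg 2 = 4 * X.T + P.length := by
      rw [dk _ (by norm_num)]; simp [bk, ak, r2]
    have v4 : σ₃.reg 4 = 4 * X.T + P.length + 2 * Q.length := by
      rw [dk _ (by norm_num)]; simp [bk, ak, r4]
    refine ⟨?_, ?_, ?_, ?_, ?_⟩
    · simp [block, run, v2]
    · simp [block, run, v4]
    · simp [block, run, d11, hK]
    · simpa [block, run] using dm
    · intro i hi hi'
      simp [block, run, show i ≠ 13 by omega, show i ≠ 14 by omega, dk i hi', hi', bk i hi]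
  rintro σ₄ ⟨f13, f14, f11, fm, fk⟩
  set A := 4 * X.T + P.length + 2 * Q.length with hA
  have f4 : σ₄.reg 4 = A := by rw [fk 4 (by norm_num) (by norm_num), ak 4 (by norm_num), r4]
  have f9 : σ₄.reg 9 = A + 2 * Q.length := by
    rw [fk 9 (by norm_num) (by norm_num), a9]; omega
  have f10 : σ₄.reg 10 = A + 2 * Q.length + P.length + 1 := by
    rw [fk 10 (by norm_num) (by norm_num), a10]; omega
  have fin : ∀ a < A, σ₄.mem a = σ.mem a := by
    intro a ha
    rw [fm, bm a (by rw [a9]; omega), am a (by omega)]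
  have hready : Ready w X P σ₄ := by
    refine ⟨hpp, by omega, ?_, ?_, ?_, ?_, ?_, ?_, ?_, ?_, ?_⟩
    · rw [fk 5 (by norm_num) (by norm_num), a5]
    · rw [fk 6 (by norm_num) (by norm_num), a6]
    · rw [fk 7 (by norm_num) (by norm_num), a7]
    · rw [fk 12 (by norm_num) (by norm_num), a12]
    · intro R hR r hr
      rw [fin _ (by omega)]
      exact hσ.mem_data (X.getElem?_words hR hr)
    · rw [f9]; omega
    · intro j hj
      rw [fm, fk 9 (by norm_num) (by norm_num)]
      exact hI₂.hashes j hj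
    · rw [f10]; omega
    · intro j hj
      rw [fm, fk 10 (by norm_num) (by norm_num)]
      exact hI₂.powers j hj
  exact (halts_queries (K := K) hX hQ hW hσ (Nat.lt_size_self _) hA hready f4 f9 f10 f11 f13 f14 fin).mono
    (by omega) fun _ h => h

/-! ## The time bound -/

/-- Write `lg m = lg (m/x) + lg x`; the first term is at most `2 * (m/x)`, from `log y ≤ y - 1`. For
`x ≥ 2` the rounding error `1` is absorbed by `lg x ≥ 1`; for `x = 1` the bound `m.size ≤ m` is
enough. -/
theorem size_le_div_add_logb {m x : ℕ} (hm : 1 ≤ m) (hx : 1 ≤ x) :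
    (m.size : ℝ) ≤ 3 * ((m : ℝ) / x + Real.logb 2 x) := by
  have hm0 : (0 : ℝ) < m := by exact_mod_cast hm
  have hx0 : (0 : ℝ) < x := by exact_mod_cast hx
  rcases hx.lt_or_eq with hx2 | rfl
  · have hx2' : (2 : ℝ) ≤ x := by exact_mod_cast hx2
    have hlogx : 1 ≤ Real.logb 2 x := by
      rw [Real.le_logb_iff_rpow_le one_lt_two hx0]; simpa using hx2'
    have hsize : (m.size : ℝ) ≤ Real.logb 2 m + 1 := by
      obtain ⟨k, hk⟩ : ∃ k, m.size = k + 1 :=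
        Nat.exists_eq_succ_of_ne_zero (Nat.size_pos.2 hm).ne'
      have h2 : 2 ^ k ≤ m := Nat.lt_size.1 (by omega)
      have h3 : (k : ℝ) ≤ Real.logb 2 m := by
        rw [Real.le_logb_iff_rpow_le one_lt_two hm0, Real.rpow_natCast]
        exact_mod_cast h2
      rw [hk]; push_cast; linarith
    have hsplit : Real.logb 2 m = Real.logb 2 (m / x) + Real.logb 2 x := by
      rw [Real.logb_div hm0.ne' hx0.ne']; ring
    have hdiv : Real.logb 2 (m / x) ≤ 2 * ((m : ℝ) / x) := by
      have hpos : (0 : ℝ) < m / x := by positivity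
      have h1 := Real.log_le_sub_one_of_pos hpos
      have h2 := Real.log_two_gt_d9
      rw [Real.logb, div_le_iff₀ (by linarith)]
      nlinarith
    have : (0 : ℝ) < m / x := by positivity
    linarith
  · have h1 : m.size ≤ m := Nat.size_le.2 Nat.lt_two_pow_self
    have h2 : (m.size : ℝ) ≤ m := by exact_mod_cast h1
    simp
    linarith

theorem mainTheorem4 :
    -- one query program and one constant for all inputs
    ∃ (query : RamProg) (C : ℕ),
    -- all inputs are polynomially bounded in `n`, and the word size is `w ≥ c lg n`
    ∀ a : ℕ, ∃ c : ℕ, ∀ n w : ℕ, 2 ≤ n → (c : ℝ) * Real.logb 2 n ≤ w →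
    ∀ (D : Finset (List ℕ)) (x : ℕ), D.Nonempty → 1 ≤ x →
      D.card ≤ n ^ a → (∀ s ∈ D, s.length ≤ n ^ a ∧ IsStringOver (n ^ a) s) →
    -- the data structure: `O(k)` words
    ∃ data : List ℕ, data.length ≤ C * D.card ∧ (∀ v ∈ data, v < 2 ^ w) ∧
    ∀ (P : List ℕ) (Q : List (ℕ × ℕ)),
      P ≠ [] → P.length ≤ n ^ a → IsStringOver (n ^ a) P →
      Q.length ≤ n ^ a → (∀ q ∈ Q, q.1 + q.2 ≤ P.length) →
    -- the input and the answers fit into the addressable memory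
    (batchInput data P Q).length + 2 * Q.length < 2 ^ w ∧
    ∀ σ : RamState, IsBatchStart w data P Q σ →
      ∃ (σ' : RamState) (t : ℕ), RamExec w query σ σ' t ∧ IsBatchEnd D data P Q σ' ∧
        (t : ℝ) ≤ C * ((P.length : ℝ) +
          (Q.length : ℝ) * ((P.length : ℝ) / (x : ℝ) + Real.logb 2 (x : ℝ))) := by
  refine ⟨query, 1000, fun a => ⟨10 * a + 13, fun n w hn hw D x hD hx hcard hstr => ?_⟩⟩
  set N := n ^ a with hN
  have hN1 : 1 ≤ N := Nat.one_le_pow _ _ (by omega)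
  -- The constant `10 * a + 13` is chosen for this: `p * p` is at most `68 ^ 2 * N ^ 10`, and `68 ^
  -- 2 = 4624 < 2 ^ 13`.
  have hNw : 2 ^ 13 * N ^ 10 ≤ 2 ^ w := by
    have h1 : n ^ (10 * a + 13) ≤ 2 ^ w := by
      have hn0 : (0 : ℝ) < n := by exact_mod_cast (by omega : 0 < n)
      have h2 : Real.logb 2 ((n : ℝ) ^ (10 * a + 13)) ≤ w := by
        rw [Real.logb_pow]; exact_mod_cast hw
      rw [Real.logb_le_iff_le_rpow one_lt_two (by positivity), Real.rpow_natCast] at h2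
      exact_mod_cast h2
    refine le_trans ?_ h1
    rw [pow_add, mul_comm 10 a, pow_mul, ← hN, mul_comm]
    exact Nat.mul_le_mul_left _ (Nat.pow_le_pow_left hn 13)
  obtain ⟨X, hX, hp, hNp, hT⟩ := PrefixIndex.exists_isIndexOf hD hcard hstr
  have hNpow : N ≤ N ^ 10 := Nat.le_self_pow (by norm_num) N
  have hpp : X.p * X.p < 2 ^ w :=
    calc X.p * X.p ≤ 68 * N ^ 5 * (68 * N ^ 5) := Nat.mul_le_mul hp hp
      _ = 4624 * N ^ 10 := by ring
      _ < 2 ^ w := by omega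
  have hpw : X.p < 2 ^ w := lt_of_le_of_lt (Nat.le_mul_self _) hpp
  refine ⟨X.words, by rw [X.length_words]; omega, ?_, ?_⟩
  · intro v hv
    obtain ⟨i, -, rfl⟩ := List.mem_map.1 hv
    exact (hX.fld_le _ _).trans_lt hpw
  intro P Q hP hPN hPstr hQN hQ
  have hlen := length_batchInput X.words P Q
  rw [X.length_words] at hlen
  refine ⟨by omega, fun σ hσ => ?_⟩
  obtain ⟨σ', t, he, ht, hend⟩ := halts_query hX hpp (fun c hc => (hPstr c hc).2.trans hNp) hQ
    (by omega) hσ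
  refine ⟨σ', t, he, hend, ?_⟩
  have hm1 : 1 ≤ P.length := List.length_pos_iff.2 hP
  have hsize := size_le_div_add_logb hm1 hx
  have hs1 : 1 ≤ P.length.size := Nat.size_pos.2 hm1
  have hs2 : P.length.size ≤ P.length := Nat.size_le.2 Nat.lt_two_pow_self
  -- Since `P` is nonempty, its length and the binary size of its length are at least `1` and absorb
  -- all additive constants.
  have ht' : t ≤ 100 * P.length + 300 * (Q.length * P.length.size) := by
    refine ht.trans ?_
    have : Q.length * (81 * P.length.size + 153) ≤ Q.length * (300 * P.length.size) :=
      Nat.mul_le_mul_left _ (by omega)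
    have h2 : Q.length * (300 * P.length.size) = 300 * (Q.length * P.length.size) := by ring
    omega
  calc (t : ℝ) ≤ 100 * P.length + 300 * (Q.length * P.length.size) := by exact_mod_cast ht'
    _ ≤ 100 * P.length + 300 * (Q.length *
        (3 * ((P.length : ℝ) / x + Real.logb 2 x))) := by gcongr
    _ ≤ _ := by
      have h1 : (0 : ℝ) ≤ P.length := Nat.cast_nonneg _
      have h2 : 0 ≤ (Q.length : ℝ) * ((P.length : ℝ) / x + Real.logb 2 x) := by
        refine mul_nonneg (Nat.cast_nonneg _) ?_
        have := (Nat.cast_nonneg (α := ℝ) P.length.size).trans hsize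
        linarith
      push_cast
      nlinarith
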